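/- **Setup.** A DAG $\mathcal G$ on $[p]=\{1,\dots,p\}$ has *skeleton* the undirected graph with the same adjacencies; a *v-structure* of $\mathcal G$ is an induced subgraph $i\to j\leftarrow k$. Its *characteristic imset* is the vector $c_{\mathcal G}\in\{0,1\}^{\{S\subseteq[p]\,:\,|S|\ge 2\}}$ with $c_{\mathcal G}(S)=1$ if and only if there is $i\in S$ such that every element of $S\setminus\{i\}$ is a parent of $i$ in $\mathcal G$. Let $e_S$ denote the standard basis vectors, and for an undirected graph $G$ on $[p]$ put $$\mathrm{CIM}_G=\mathrm{conv}\{c_{\mathcal G} : \mathcal G \text{ a DAG with skeleton } G\}.$$ Let $I_p$ be the path $1-2-\cdots-p$ and $C_p$ the cycle obtained from it by adding the edge $\{1,p\}$. An *edge* of a polytope is a one-dimensional face. Let $\mathcal G,\mathcal H$ be DAGs with the same skeleton $G$. For a sequence $\pi=\langle i_0,i_1,\dots,i_n\rangle$ of nodes put $S_j=\{i_{j-1},i_j,i_{j+1}\}$ for $0<j<n$. We say that $\pi$ *runs along* $G$ if consecutive nodes of $\pi$ are adjacent in $G$, the inner nodes $i_1,\dots,i_{n-1}$ are distinct, and $i_{j-1},i_{j+1}$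 are distinct and non-adjacent in $G$ for all $0<j<n$. (If $G=I_p$, such a sequence has pairwise distinct nodes, i.e. it is a path. If $G=C_p$, it may go around the cycle, so the end nodes $i_0,i_n$ may repeat other nodes of $\pi$.) The unordered pair $\{\mathcal G,\mathcal H\}$ is * a *v-structure addition* if, up to exchanging $\mathcal G$ and $\mathcal H$, $c_{\mathcal H}=c_{\mathcal G}+e_S$ for some $S\subseteq[p]$ with $|S|=3$; * a *shift* if, up to exchanging $\mathcal G$ and $\mathcal H$, there are $m\ge1$ and a sequence $\langle i_0,\dots,i_{2m+1}\rangle$ running along $G$ such that $$c_{\mathcal H}-\sum_{j=1,3,\dots,2m-1}e_{S_j}=c_{\mathcal G}-\sum_{j=2,4,\dots,2m}e_{S_j};$$ * a *split* if, up to exchanging $\mathcal G$ and $\mathcal H$, there are $m\ge1$ and a sequence $\langle i_0,\dots,i_{2m}\rangle$ running along $G$ such that $$c_{\mathcal H}-\sum_{j=1,3,\dots,2m-1}e_{S_j}=c_{\mathcal G}-\sum_{j=2,4,\dots,2m-2}e_{S_j}.$$ **Theorem.** 1. Let $p\ge2$ and let $\mathcal G,\mathcal H$ be DAGs with skeleton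 $I_p$. Then $\mathrm{conv}(c_{\mathcal G},c_{\mathcal H})$ is an edge of $\mathrm{CIM}_{I_p}$ if and only if $\{\mathcal G,\mathcal H\}$ is a v-structure addition, a shift, or a split. 2. Let $p\ge3$ and let $\mathcal G,\mathcal H$ be DAGs with skeleton $C_p$. Then $\mathrm{conv}(c_{\mathcal G},c_{\mathcal H})$ is an edge of $\mathrm{CIM}_{C_p}$ if and only if $\{\mathcal G,\mathcal H\}$ is a v-structure addition, a shift, or a split, or $c_{\mathcal G}\neq c_{\mathcal H}$ and each of $\mathcal G$ and $\mathcal H$ contains exactly one v-structure. -/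

import Mathlib

/-- A directed acyclic graph with node set `Fin p`: no node can be reached from itself by a
nonempty directed walk. -/
structure DAG (p : ℕ) extends Digraph (Fin p) where
  acyclic : ∀ v, ¬ Relation.TransGen Adj v v

namespace DAG

/-- The skeleton: the undirected graph with the same adjacencies. -/
def skeleton {p : ℕ} (G : DAG p) : SimpleGraph (Fin p) :=
  G.toDigraph.toSimpleGraphInclusive

/-- The set of parents of `i`. -/
def parents {p : ℕ} (G : DAG p) (i : Fin p) : Set (Fin p) :=
  {j | G.Adj j i}

/-- `i → j ← k` is an induced subgraph. -/
def IsVStructure {p : ℕ} (G : DAG p) (i j k : Fin p) : Prop :=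
  i ≠ k ∧ G.Adj i j ∧ G.Adj k j ∧ ¬ G.skeleton.Adj i k

/-- The set of v-structures `i → j ← k`, each recorded once, as the unordered pair of the two
parents together with the common child. -/
def vStructures {p : ℕ} (G : DAG p) : Set (Sym2 (Fin p) × Fin p) :=
  {x | ∃ i j k, G.IsVStructure i j k ∧ x = (s(i, k), j)}

end DAG

/-- The space of real vectors with coordinates indexed by the subsets of `Fin p` with at least two
elements. -/
abbrev ImsetSpace (p : ℕ) : Type := {S : Finset (Fin p) // 2 ≤ S.card} → ℝ

/-- The standard basis vector `e_T` (for `T` with at least two elements). -/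
def basisVec {p : ℕ} (T : Finset (Fin p)) : ImsetSpace p :=
  fun S => if S.1 = T then 1 else 0

open Classical in
/-- The characteristic imset of a DAG. -/
noncomputable def DAG.imset {p : ℕ} (G : DAG p) : ImsetSpace p :=
  fun S => if ∃ i ∈ S.1, ∀ j ∈ S.1, j ≠ i → j ∈ G.parents i then 1 else 0

/-- The polytope `CIM_G`: the convex hull of the characteristic imsets of all DAGs with
skeleton `G`. -/
def CIM {p : ℕ} (G : SimpleGraph (Fin p)) : Set (ImsetSpace p) :=
  convexHull ℝ {c | ∃ D : DAG p, D.skeleton = G ∧ D.imset = c}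

/-- `E` is an edge of the polytope `P`: a face (the set of maximizers over `P` of a linear
functional) of dimension one. -/
def IsPolytopeEdge {p : ℕ} (P E : Set (ImsetSpace p)) : Prop :=
  E.Nonempty ∧ IsExposed ℝ P E ∧ Module.finrank ℝ (vectorSpan ℝ E) = 1

/-- The pair `{G, H}` is a v-structure addition: the imset of one of the two is obtained from that
of the other by adding `e_T` for a three-element set `T`. -/
def IsVStructureAddition {p : ℕ} (G H : DAG p) : Prop :=
  ∃ T : Finset (Fin p), T.card = 3 ∧
    (H.imset = G.imset + basisVec T ∨ G.imset = H.imset + basisVec T)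

/-- The finite sequence `π 0, …, π n` runs along a path of `G`, where the path may close up, as it
does when one goes around a cycle: consecutive nodes are adjacent, the inner nodes
`π 1, …, π (n - 1)` are distinct, and any three consecutive nodes induce a path of length two.
If `G` is a path graph, the nodes `π 0, …, π n` are automatically distinct. If `G` is a cycle, the
end nodes `π 0` and `π n` may repeat other nodes. Only the values `π 0, …, π n` matter. -/
structure RunsAlong {p : ℕ} (G : SimpleGraph (Fin p)) (n : ℕ) (π : ℕ → Fin p) : Prop where
  adj : ∀ k < n, G.Adj (π k) (π (k + 1))
  inner_injOn : Set.InjOn π (Set.Ioo 0 n)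
  induced : ∀ k, k + 2 ≤ n → π k ≠ π (k + 2) ∧ ¬ G.Adj (π k) (π (k + 2))

/-- The set `{π (j - 1), π j, π (j + 1)}` (used for `1 ≤ j`). -/
def triple {p : ℕ} (π : ℕ → Fin p) (j : ℕ) : Finset (Fin p) :=
  {π (j - 1), π j, π (j + 1)}

/-- The triples of `π` with odd centre `j = 1, 3, …, 2 m - 1`. -/
def oddTriples {p : ℕ} (π : ℕ → Fin p) (m : ℕ) : Finset (Finset (Fin p)) :=
  (Finset.range m).image fun t => triple π (2 * t + 1)

/-- The triples of `π` with even centre `j = 2, 4, …, 2 m`. -/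
def evenTriples {p : ℕ} (π : ℕ → Fin p) (m : ℕ) : Finset (Finset (Fin p)) :=
  (Finset.range m).image fun t => triple π (2 * t + 2)

/-- The ordered form of a shift, along `π 0, …, π (2 m + 1)`, from `G` to `H`. -/
def IsShiftFrom {p : ℕ} (G H : DAG p) : Prop :=
  ∃ (m : ℕ) (π : ℕ → Fin p), 1 ≤ m ∧
    RunsAlong G.skeleton (2 * m + 1) π ∧ RunsAlong H.skeleton (2 * m + 1) π ∧
    H.imset - ∑ S ∈ oddTriples π m, basisVec S = G.imset - ∑ S ∈ evenTriples π m, basisVec S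

/-- The ordered form of a split, along `π 0, …, π (2 m)`, from `G` to `H`; here the even centres
are `2, 4, …, 2 m - 2`. -/
def IsSplitFrom {p : ℕ} (G H : DAG p) : Prop :=
  ∃ (m : ℕ) (π : ℕ → Fin p), 1 ≤ m ∧
    RunsAlong G.skeleton (2 * m) π ∧ RunsAlong H.skeleton (2 * m) π ∧
    H.imset - ∑ S ∈ oddTriples π m, basisVec S =
      G.imset - ∑ S ∈ evenTriples π (m - 1), basisVec S

/-- The unordered pair `{G, H}` is a shift. -/
def IsShift {p : ℕ} (G H : DAG p) : Prop := IsShiftFrom G H ∨ IsShiftFrom H G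

/-- The unordered pair `{G, H}` is a split. -/
def IsSplit {p : ℕ} (G H : DAG p) : Prop := IsSplitFrom G H ∨ IsSplitFrom H G

set_option linter.unusedSectionVars false

/-! The path and the cycle are treated together as graphs whose edges join `x` and `x + 1` only.
Non-adjacent parents of `x` are then `x - 1` and `x + 1`, so an imset carries the same information
as the set of colliders, and colliders are pairwise non-adjacent inner nodes. Conversely every such
set occurs (`exists_colliders_eq`), except the empty one on a cycle of length at least four, where a
sink is always a collider. Up to constant coordinates the polytope is thus the stable set polytope
of the inner nodes, with the origin removed in the case of the cycle.

As for stable set polytopes, adjacency of collider sets `A` and `B` is governed by connectedness of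
`U = symmDiff A B`. If `U` is connected, a functional that rewards alternation along the edges
inside `U` and agreement with `A` and `B` outside `U` is maximal at these two vertices only
(`isPolytopeEdge_of_isLinked`). If `U` is disconnected, exchanging a union of components between `A`
and `B` gives two other vertices with the same sum, which an edge forbids
(`IsPolytopeEdge.exchange`). On the cycle the exchange is blocked when it produces the empty set;
this leaves only pairs of singletons (`IsPolytopeEdge.isLinked_or_singletons`), and these do span
edges (`isPolytopeEdge_of_singletons`).

Finally, a connected `U` is an arc, possibly the whole cycle, on which `A` and `B` alternate: an
even number of nodes gives a shift, an odd number a split. A v-structure addition is the case of one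
node. -/

/-- In a subgraph of the cycle, every edge joins cyclically consecutive nodes. -/
def IsCircular {p : ℕ} [NeZero p] (Γ : SimpleGraph (Fin p)) : Prop :=
  ∀ x y, Γ.Adj x y → y = x + 1 ∨ x = y + 1

/-- The node `x` is the centre of the induced path `x - 1, x, x + 1`. -/
structure IsInner {p : ℕ} [NeZero p] (Γ : SimpleGraph (Fin p)) (x : Fin p) : Prop where
  ne : x - 1 ≠ x + 1
  not_adj : ¬ Γ.Adj (x - 1) (x + 1)
  adj_left : Γ.Adj (x - 1) x
  adj_right : Γ.Adj (x + 1) x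

/-- The three cyclically consecutive nodes centred at `x`. -/
def window {p : ℕ} [NeZero p] (x : Fin p) : Finset (Fin p) := {x - 1, x, x + 1}

/-- The set of colliders of a DAG with circular skeleton. -/
def DAG.colliders {p : ℕ} [NeZero p] (D : DAG p) : Set (Fin p) :=
  {x | IsInner D.skeleton x ∧ D.Adj (x - 1) x ∧ D.Adj (x + 1) x}

namespace DAG

theorem irrefl {p : ℕ} (D : DAG p) (x : Fin p) : ¬ D.Adj x x :=
  fun h => D.acyclic x (.single h)

theorem asymm {p : ℕ} (D : DAG p) {x y : Fin p} (h : D.Adj x y) : ¬ D.Adj y x :=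
  fun h' => D.acyclic x (.tail (.single h) h')

theorem skeleton_adj {p : ℕ} (D : DAG p) {x y : Fin p} :
    D.skeleton.Adj x y ↔ D.Adj x y ∨ D.Adj y x := by
  have : D.skeleton.Adj x y ↔ x ≠ y ∧ (D.Adj x y ∨ D.Adj y x) := Iff.rfl
  rw [this]
  constructor
  · exact fun h => h.2
  · intro h
    refine ⟨?_, h⟩
    rintro rfl
    exact D.irrefl x (h.elim id id)

/-- Every nonempty set of nodes contains a node without children in this set. -/
theorem exists_sink {p : ℕ} (D : DAG p) (S : Set (Fin p)) (hS : S.Nonempty) :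
    ∃ x ∈ S, ∀ y ∈ S, ¬ D.Adj x y := by
  let r : Fin p → Fin p → Prop := fun x y => Relation.TransGen D.Adj y x
  have : IsTrans (Fin p) r := ⟨fun a b c h₁ h₂ => h₂.trans h₁⟩
  have : Std.Irrefl r := ⟨fun a h => D.acyclic a h⟩
  obtain ⟨x, hx, h⟩ := (Finite.wellFounded_of_trans_of_irrefl r).has_min S hS
  exact ⟨x, hx, fun y hy hxy => h y hy (.single hxy)⟩

end DAG

/-! ### Imsets as collider sets -/

section Classification

variable {p : ℕ} [NeZero p] {Γ : SimpleGraph (Fin p)}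

theorem IsCircular.eq_of_adj (hΓ : IsCircular Γ) {x y : Fin p} (h : Γ.Adj y x) :
    y = x - 1 ∨ y = x + 1 := by
  rcases hΓ _ _ h with h | h
  · left; rw [h]; simp
  · right; exact h

/-- The centre is the only node of its window adjacent to both others: were an end of `window x`
also a centre, it would be adjacent to the other end. -/
theorem IsInner.window_injective {x y : Fin p} (hx : IsInner Γ x)
    (hy : IsInner Γ y) (h : window x = window y) : x = y := by
  have key : ∀ {x y : Fin p}, IsInner Γ x → IsInner Γ y → window x = window y →
      ∀ z ∈ window x, z ≠ y → Γ.Adj z y := by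
    intro x y _ hy h z hz hzy
    rw [h] at hz
    simp only [window, Finset.mem_insert, Finset.mem_singleton] at hz
    rcases hz with rfl | rfl | rfl
    · exact hy.adj_left
    · exact absurd rfl hzy
    · exact hy.adj_right
  by_contra hne
  have hym : y ∈ window x := by rw [h]; simp [window]
  simp only [window, Finset.mem_insert, Finset.mem_singleton] at hym
  rcases hym with rfl | rfl | rfl
  · exact hx.not_adj (key hx hy h (x + 1) (by simp [window]) (Ne.symm hx.ne)).symm
  · exact hne rfl
  · exact hx.not_adj (key hx hy h (x - 1) (by simp [window]) hx.ne)

theorem IsInner.not_isClique_window {x : Fin p} (hx : IsInner Γ x) :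
    ¬ Γ.IsClique (window x : Set (Fin p)) := fun h =>
  hx.not_adj (h (by simp [window]) (by simp [window]) hx.ne)

theorem IsInner.card_window {x : Fin p} (hx : IsInner Γ x) : (window x).card = 3 := by
  rw [window, Finset.card_eq_three]
  exact ⟨_, _, _, hx.adj_left.ne, hx.ne, hx.adj_right.ne.symm, rfl⟩

theorem IsInner.two_le_card_window {x : Fin p} (hx : IsInner Γ x) : 2 ≤ (window x).card := by
  rw [hx.card_window]; norm_num

namespace DAG

theorem mem_colliders_of_adj (hΓ : IsCircular Γ) {D : DAG p} (hD : D.skeleton = Γ)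
    {i j k : Fin p} (hij : D.Adj i j) (hkj : D.Adj k j) (hik : i ≠ k) (h : ¬ Γ.Adj i k) :
    j ∈ D.colliders ∧ (i = j - 1 ∧ k = j + 1 ∨ i = j + 1 ∧ k = j - 1) := by
  subst hD
  have hi := hΓ.eq_of_adj (D.skeleton_adj.2 (.inl hij))
  have hk := hΓ.eq_of_adj (D.skeleton_adj.2 (.inl hkj))
  have hi' := D.skeleton_adj.2 (.inl hij)
  have hk' := D.skeleton_adj.2 (.inl hkj)
  rcases hi with rfl | rfl <;> rcases hk with rfl | rfl
  · exact absurd rfl hik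
  · exact ⟨⟨⟨hik, h, hi', hk'⟩, hij, hkj⟩, .inl ⟨rfl, rfl⟩⟩
  · exact ⟨⟨⟨hik.symm, fun h' => h h'.symm, hk', hi'⟩, hkj, hij⟩, .inr ⟨rfl, rfl⟩⟩
  · exact absurd rfl hik

/-- A sink of the clique has all its other members as parents. -/
theorem imset_of_isClique {D : DAG p} (hD : D.skeleton = Γ)
    (S : {S : Finset (Fin p) // 2 ≤ S.card}) (hS : Γ.IsClique (S.1 : Set (Fin p))) :
    D.imset S = 1 := by
  subst hD
  have hne : (S.1 : Set (Fin p)).Nonempty := by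
    have := S.2
    exact Finset.card_pos.1 (by omega)
  obtain ⟨i, hi, h⟩ := D.exists_sink _ hne
  refine if_pos ⟨i, hi, fun j hj hji => ?_⟩
  exact (D.skeleton_adj.1 (hS hj hi hji)).resolve_right (h j hj)

-- A node with all of `S` among its parents has two non-adjacent parents there. They are its two
-- cyclic neighbours, and circularity leaves no room for a further element of `S`.
open Classical in
theorem imset_of_not_isClique (hΓ : IsCircular Γ) {D : DAG p} (hD : D.skeleton = Γ)
    (S : {S : Finset (Fin p) // 2 ≤ S.card}) (hS : ¬ Γ.IsClique (S.1 : Set (Fin p))) :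
    D.imset S = if ∃ x ∈ D.colliders, window x = S.1 then 1 else 0 := by
  unfold imset
  refine if_congr ⟨?_, ?_⟩ rfl rfl
  · rintro ⟨i, hi, h⟩
    have hpar : ∀ j ∈ S.1, j ≠ i → Γ.Adj j i := fun j hj hji =>
      hD ▸ D.skeleton_adj.2 (.inl (h j hj hji))
    simp only [SimpleGraph.IsClique, Set.Pairwise] at hS
    push Not at hS
    obtain ⟨a, ha, b, hb, hab, hadj⟩ := hS
    have hai : a ≠ i := by
      rintro rfl; exact hadj (hpar b hb hab.symm).symm
    have hbi : b ≠ i := by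
      rintro rfl; exact hadj (hpar a ha hab)
    obtain ⟨hc, hor⟩ := mem_colliders_of_adj hΓ hD (h a ha hai) (h b hb hbi) hab hadj
    refine ⟨i, hc, ?_⟩
    have hi1 : i - 1 ∈ S.1 ∧ i + 1 ∈ S.1 := by
      rcases hor with ⟨rfl, rfl⟩ | ⟨rfl, rfl⟩
      · exact ⟨ha, hb⟩
      · exact ⟨hb, ha⟩
    ext z
    simp only [window, Finset.mem_insert, Finset.mem_singleton]
    constructor
    · rintro (rfl | rfl | rfl)
      exacts [hi1.1, hi, hi1.2]
    · intro hz
      by_cases hzi : z = i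
      · exact .inr (.inl hzi)
      · rcases hΓ.eq_of_adj (hpar z hz hzi) with h | h
        · exact .inl h
        · exact .inr (.inr h)
  · rintro ⟨x, hx, hxS⟩
    refine ⟨x, ?_, ?_⟩
    · rw [← hxS]; simp [window]
    · intro j hj hjx
      rw [← hxS] at hj
      simp only [window, Finset.mem_insert, Finset.mem_singleton] at hj
      rcases hj with rfl | rfl | rfl
      exacts [hx.2.1, absurd rfl hjx, hx.2.2]

theorem isInner_of_mem_colliders {D : DAG p} (hD : D.skeleton = Γ) {x : Fin p}
    (hx : x ∈ D.colliders) : IsInner Γ x := hD ▸ hx.1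

open Classical in
theorem imset_window (hΓ : IsCircular Γ) {D : DAG p} (hD : D.skeleton = Γ) {x : Fin p}
    (hx : IsInner Γ x) :
    D.imset ⟨window x, hx.two_le_card_window⟩ = if x ∈ D.colliders then 1 else 0 := by
  rw [imset_of_not_isClique hΓ hD _ hx.not_isClique_window]
  refine if_congr ⟨?_, fun h => ⟨x, h, rfl⟩⟩ rfl rfl
  rintro ⟨y, hy, hyx⟩
  rwa [← (isInner_of_mem_colliders hD hy).window_injective hx hyx]

/-- The colliders of a DAG are pairwise non-adjacent. -/
theorem colliders_indep (hΓ : IsCircular Γ) {D : DAG p} {x y : Fin p}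
    (hx : x ∈ D.colliders) (hy : y ∈ D.colliders) : ¬ Γ.Adj x y := by
  have key : ∀ {x y : Fin p}, x ∈ D.colliders → Γ.Adj y x → D.Adj y x := by
    intro x y hx h
    rcases hΓ.eq_of_adj h with rfl | rfl
    exacts [hx.2.1, hx.2.2]
  exact fun h => D.asymm (key hy h) (key hx h.symm)

theorem colliders_eq_of_imset_eq (hΓ : IsCircular Γ) {D E : DAG p} (hD : D.skeleton = Γ)
    (hE : E.skeleton = Γ) (h : D.imset = E.imset) : D.colliders = E.colliders := by
  classical
  ext x
  by_cases hx : IsInner Γ x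
  · have := congrFun h ⟨window x, hx.two_le_card_window⟩
    rw [imset_window hΓ hD hx, imset_window hΓ hE hx] at this
    split_ifs at this with h₁ h₂ <;> simp_all
  · exact iff_of_false (fun h => hx (isInner_of_mem_colliders hD h))
      (fun h => hx (isInner_of_mem_colliders hE h))

theorem imset_eq_of_colliders_eq (hΓ : IsCircular Γ) {D E : DAG p} (hD : D.skeleton = Γ)
    (hE : E.skeleton = Γ) (h : D.colliders = E.colliders) : D.imset = E.imset := by
  classical
  ext S
  by_cases hS : Γ.IsClique (S.1 : Set (Fin p))
  · rw [imset_of_isClique hD S hS, imset_of_isClique hE S hS]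
  · rw [imset_of_not_isClique hΓ hD S hS, imset_of_not_isClique hΓ hE S hS, h]

theorem vStructures_eq (hΓ : IsCircular Γ) {D : DAG p} (hD : D.skeleton = Γ) :
    D.vStructures = (fun x => (s(x - 1, x + 1), x)) '' D.colliders := by
  ext v
  constructor
  · rintro ⟨i, j, k, ⟨hik, hij, hkj, hn⟩, rfl⟩
    obtain ⟨hj, h⟩ := mem_colliders_of_adj hΓ hD hij hkj hik (hD ▸ hn)
    refine ⟨j, hj, ?_⟩
    rcases h with ⟨rfl, rfl⟩ | ⟨rfl, rfl⟩
    · rfl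
    · rw [Sym2.eq_swap]
  · rintro ⟨x, hx, rfl⟩
    exact ⟨x - 1, x, x + 1, ⟨hx.1.ne, hx.2.1, hx.2.2, hx.1.not_adj⟩, rfl⟩

theorem ncard_vStructures (hΓ : IsCircular Γ) {D : DAG p} (hD : D.skeleton = Γ) :
    D.vStructures.ncard = D.colliders.ncard := by
  rw [vStructures_eq hΓ hD]
  exact Set.ncard_image_of_injective _ fun x y h => (Prod.ext_iff.1 h).2

end DAG

/-- A DAG with prescribed pairwise non-adjacent colliders exists, provided that a node `s` breaks
up the cyclic order. -/
theorem exists_colliders_eq (hΓ : IsCircular Γ) (A : Set (Fin p)) (hI : ∀ x ∈ A, IsInner Γ x)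
    (hA : ∀ x ∈ A, ∀ y ∈ A, ¬ Γ.Adj x y) (h3 : ∀ x : Fin p, x - 1 ≠ x + 1) (s : Fin p)
    (hs : Γ.Adj s (s - 1) → s ∈ A) :
    ∃ D : DAG p, D.skeleton = Γ ∧ D.colliders = A := by
  classical
  -- The edge between `x` and `x + 1` points up exactly when `x + 1 ∈ A`, and down otherwise.
  let r : Fin p → Fin p → Prop := fun u v =>
    Γ.Adj u v ∧ ((v = u + 1 ∧ v ∈ A) ∨ (u = v + 1 ∧ u ∉ A))
  -- Acyclicity comes from a height that drops along every arc. Nodes of `A` lie at the bottom, the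
  -- others are ranked by cyclic distance from `s`; only the arc from `s` to `s - 1` could spoil
  -- this, and `hs` excludes it.
  let h : Fin p → ℕ := fun x => if x ∈ A then 0 else 1 + (x - s).val
  have hr : ∀ u v, r u v → h v < h u := by
    rintro u v ⟨huv, ⟨rfl, hv⟩ | ⟨rfl, hu⟩⟩
    · have hu : u ∉ A := fun hu => hA _ hu _ hv huv
      simp [h, hv, hu]
    · by_cases hv : v ∈ A
      · simp [h, hv, hu]
      · simp only [h, hv, hu, if_false]
        have hne : v + 1 ≠ s := by
          rintro rfl
          exact hu (hs (by simpa using huv))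
        have e : v + 1 - s = (v - s) + 1 := by abel
        have hne0 : (v - s) + 1 ≠ 0 := by
          rw [← e]; exact sub_ne_zero.2 hne
        have hlt : (v - s).val + 1 < p := by
          by_contra hc
          apply hne0
          apply Fin.ext
          have h1 := (v - s).isLt
          rw [Fin.val_add]
          have h2 : (v - s).val + 1 = p := by omega
          rcases Nat.lt_or_ge 1 p with hp | hp
          · have : ((1 : Fin p)).val = 1 := by
              rw [Fin.val_one', Nat.mod_eq_of_lt hp]
            rw [this, h2]; simp
          · have : p = 1 := by omega
            subst this; simp
        have : ((v - s) + 1).val = (v - s).val + 1 := Fin.val_add_one_of_lt' hlt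
        rw [e, this]; omega
  have htrans : ∀ u v, Relation.TransGen r u v → h v < h u := by
    intro u v huv
    induction huv with
    | single h => exact hr _ _ h
    | tail _ h ih => exact (hr _ _ h).trans ih
  let D : DAG p := ⟨⟨r⟩, fun v hv => lt_irrefl _ (htrans v v hv)⟩
  have hDadj : ∀ u v, D.Adj u v ↔ r u v := fun _ _ => Iff.rfl
  have hD : D.skeleton = Γ := by
    ext u v
    rw [DAG.skeleton_adj, hDadj, hDadj]
    constructor
    · rintro (h | h)
      exacts [h.1, h.1.symm]
    · intro huv
      rcases hΓ _ _ huv with h | h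
      · by_cases hv : v ∈ A
        · exact .inl ⟨huv, .inl ⟨h, hv⟩⟩
        · exact .inr ⟨huv.symm, .inr ⟨h, hv⟩⟩
      · by_cases hu : u ∈ A
        · exact .inr ⟨huv.symm, .inl ⟨h, hu⟩⟩
        · exact .inl ⟨huv, .inr ⟨h, hu⟩⟩
  refine ⟨D, hD, ?_⟩
  ext x
  constructor
  · rintro ⟨-, ⟨-, ⟨-, h⟩ | ⟨h, -⟩⟩, -⟩
    · exact h
    · exact absurd h (h3 x)
  · intro hx
    have hi := hI x hx
    refine ⟨hD ▸ hi, ⟨hi.adj_left, .inl ⟨by simp, hx⟩⟩, hi.adj_right, .inr ⟨rfl, ?_⟩⟩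
    exact fun h => hA _ h _ hx hi.adj_right

end Classification

/-! ### Segments exposed by linear functionals -/

section Convexity

variable {E : Type*} [AddCommGroup E] [Module ℝ E]

theorem finrank_vectorSpan_convexHull_pair {a b : E} :
    Module.finrank ℝ (vectorSpan ℝ (convexHull ℝ {a, b})) = 1 ↔ a ≠ b := by
  rw [← direction_affineSpan, affineSpan_convexHull, direction_affineSpan, vectorSpan_pair]
  constructor
  · rintro h rfl
    rw [vsub_self, Submodule.span_zero_singleton, finrank_bot] at h
    exact zero_ne_one h
  · intro h
    exact finrank_span_singleton (by simpa [sub_eq_zero] using h)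

/-- The alternative in the conclusion describes a convex set `C` containing `V`, hence it holds on
the whole hull. -/
theorem mem_convexHull_pair_of_isMaxOn {V : Set E} {a b : E} (l : E →ₗ[ℝ] ℝ)
    (hV : ∀ v ∈ V, l v ≤ l a) (hVeq : ∀ v ∈ V, l v = l a → v = a ∨ v = b)
    {x : E} (hx : x ∈ convexHull ℝ V) : l x < l a ∨ l x = l a ∧ x ∈ convexHull ℝ {a, b} := by
  let C : Set E := {x | l x < l a ∨ l x = l a ∧ x ∈ convexHull ℝ {a, b}}
  have hC : Convex ℝ C := by
    intro x hx y hy s t hs ht hst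
    have hle : ∀ z ∈ C, l z ≤ l a := fun z hz => hz.elim le_of_lt fun h => h.1.le
    have hlx := hle x hx
    have hly := hle y hy
    have hl : l (s • x + t • y) = s * l x + t * l y := by simp
    have hsum : s * l a + t * l a = l a := by rw [← add_mul, hst, one_mul]
    -- Zero weights are split off because strict inequality survives only multiplication by a
    -- positive weight.
    rcases hs.eq_or_lt with rfl | hs'
    · have : t = 1 := by linarith
      subst this
      simpa using hy
    rcases ht.eq_or_lt with rfl | ht'
    · have : s = 1 := by linarith
      subst this
      simpa using hx
    have hx1 := mul_le_mul_of_nonneg_left hlx hs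
    have hy1 := mul_le_mul_of_nonneg_left hly ht
    rcases hx with hx | ⟨hx, hx'⟩
    · left
      have := mul_lt_mul_of_pos_left hx hs'
      rw [hl]; linarith
    rcases hy with hy | ⟨hy, hy'⟩
    · left
      have := mul_lt_mul_of_pos_left hy ht'
      rw [hl]; linarith
    · right
      exact ⟨by rw [hl, hx, hy, hsum], convex_convexHull ℝ _ hx' hy' hs ht hst⟩
  refine convexHull_min (s := V) (t := C) ?_ hC hx
  intro v hv
  rcases (hV v hv).lt_or_eq with h | h
  · exact .inl h
  · refine .inr ⟨h, subset_convexHull ℝ _ ?_⟩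
    exact hVeq v hv h

end Convexity

theorem isPolytopeEdge_of_isMaxOn {p : ℕ} {V : Set (ImsetSpace p)} {a b : ImsetSpace p}
    (ha : a ∈ V) (hb : b ∈ V) (hne : a ≠ b) (l : ImsetSpace p →L[ℝ] ℝ) (hab : l a = l b)
    (hV : ∀ v ∈ V, l v ≤ l a) (hVeq : ∀ v ∈ V, l v = l a → v = a ∨ v = b) :
    IsPolytopeEdge (convexHull ℝ V) (convexHull ℝ {a, b}) := by
  refine ⟨⟨a, subset_convexHull ℝ _ (by simp)⟩, fun _ => ⟨l, ?_⟩,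
    finrank_vectorSpan_convexHull_pair.2 hne⟩
  have key : ∀ x ∈ convexHull ℝ V, l x < l a ∨ l x = l a ∧ x ∈ convexHull ℝ {a, b} :=
    fun x hx => mem_convexHull_pair_of_isMaxOn (l : ImsetSpace p →ₗ[ℝ] ℝ) hV hVeq hx
  have hsub : convexHull ℝ {a, b} ⊆ convexHull ℝ V :=
    convexHull_mono (by rintro x (rfl | rfl) <;> assumption)
  have hconst : ∀ x ∈ convexHull ℝ {a, b}, l a ≤ l x := by
    intro x hx
    refine convexHull_min (s := {a, b}) (t := {x | l a ≤ l x}) ?_ ?_ hx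
    · rintro x (rfl | rfl)
      exacts [le_refl (l _), hab.le]
    · exact convex_halfSpace_ge (l : ImsetSpace p →ₗ[ℝ] ℝ).isLinear _
  ext x
  constructor
  · intro hx
    refine ⟨hsub hx, fun y hy => le_trans ?_ (hconst x hx)⟩
    exact (key y hy).elim le_of_lt fun h => h.1.le
  · rintro ⟨hx, hmax⟩
    exact ((key x hx).resolve_left
      (not_lt.2 (hmax a (subset_convexHull ℝ _ ha)))).2

theorem IsPolytopeEdge.ne {p : ℕ} {V : Set (ImsetSpace p)} {a b : ImsetSpace p}
    (h : IsPolytopeEdge (convexHull ℝ V) (convexHull ℝ {a, b})) : a ≠ b :=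
  finrank_vectorSpan_convexHull_pair.1 h.2.2

/-- If the midpoint of an edge of a 0/1-polytope is also the midpoint of two other points of the
polytope, then one of these points is an end of the edge. -/
theorem IsPolytopeEdge.eq_or_eq_of_add_eq {p : ℕ} {V : Set (ImsetSpace p)}
    {a b a' b' : ImsetSpace p} (h : IsPolytopeEdge (convexHull ℝ V) (convexHull ℝ {a, b}))
    (hV : ∀ v ∈ V, ∀ S, v S = 0 ∨ v S = 1) (ha : a ∈ V) (hb : b ∈ V) (ha' : a' ∈ V)
    (hb' : b' ∈ V) (hadd : a' + b' = a + b) : a' = a ∨ a' = b := by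
  have hne := h.ne
  obtain ⟨hnon, hexp, -⟩ := h
  obtain ⟨l, hl⟩ := hexp hnon
  have hmem : ∀ {v}, v ∈ V → v ∈ convexHull ℝ V := fun hv => subset_convexHull ℝ _ hv
  have hA : a ∈ convexHull ℝ {a, b} := subset_convexHull ℝ _ (by simp)
  have hB : b ∈ convexHull ℝ {a, b} := subset_convexHull ℝ _ (by simp)
  rw [hl] at hA hB
  have hsum : l a' + l b' = l a + l b := by rw [← map_add, hadd, map_add]
  have h1 := hB.2 _ (hmem hb')
  have ha'h : a' ∈ convexHull ℝ {a, b} := by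
    rw [hl]
    refine ⟨hmem ha', fun y hy => ?_⟩
    have := hA.2 y hy
    linarith
  rw [convexHull_pair] at ha'h
  obtain ⟨s, t, hs, ht, hst, rfl⟩ := ha'h
  -- At a coordinate where `a` and `b` differ, the value of `a'` is `s` or `t = 1 - s`; being 0 or
  -- 1, it places `a'` at an end of the segment.
  obtain ⟨S, hS⟩ := Function.ne_iff.1 hne
  have h2 := hV _ ha' S
  simp only [Pi.add_apply, Pi.smul_apply, smul_eq_mul] at h2
  have hs01 : s = 0 ∨ s = 1 := by
    rcases hV a ha S with e1 | e1 <;> rcases hV b hb S with e2 | e2 <;> rw [e1, e2] at h2 hS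
    · exact absurd rfl hS
    · rcases h2 with h2 | h2
      · right; linarith
      · left; linarith
    · rcases h2 with h2 | h2
      · left; linarith
      · right; linarith
    · exact absurd rfl hS
  rcases hs01 with rfl | rfl
  · right
    have : t = 1 := by linarith
    subst this; simp
  · left
    have : t = 0 := by linarith
    subst this; simp

/-- The subgraph of `Γ` induced on `U` has no proper nonempty union of components. -/
def IsLinked {V : Type*} (Γ : SimpleGraph V) (U : Set V) : Prop :=
  ∀ P : Set V, (∀ x ∈ U, ∀ y ∈ U, Γ.Adj x y → x ∈ P → y ∈ P) → ∀ x ∈ U, x ∈ P → U ⊆ P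

/-! ### Linear functionals and exchanges -/

section EdgeCriterion

variable {p : ℕ} [NeZero p] {Γ : SimpleGraph (Fin p)}

open Classical in
/-- The coordinate of an imset which records whether `x` is a collider. -/
noncomputable def colliderCoord (Γ : SimpleGraph (Fin p)) (x : Fin p) : ImsetSpace p →L[ℝ] ℝ :=
  if h : IsInner Γ x then
    ContinuousLinearMap.proj (R := ℝ) (φ := fun _ => ℝ)
      (⟨window x, h.two_le_card_window⟩ : {S : Finset (Fin p) // 2 ≤ S.card})
  else 0

open Classical in
theorem colliderCoord_imset (hΓ : IsCircular Γ) {D : DAG p} (hD : D.skeleton = Γ) (x : Fin p) :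
    colliderCoord Γ x D.imset = if x ∈ D.colliders then 1 else 0 := by
  unfold colliderCoord
  by_cases hx : IsInner Γ x
  · rw [dif_pos hx]
    exact DAG.imset_window hΓ hD hx
  · rw [dif_neg hx, if_neg fun h => hx (DAG.isInner_of_mem_colliders hD h)]
    rfl

theorem DAG.imset_eq_zero_or_one (D : DAG p) (S) : D.imset S = 0 ∨ D.imset S = 1 := by
  classical
  unfold DAG.imset
  split_ifs <;> simp

/-- Along an edge inside the symmetric difference, membership alternates between the two independent
sets. -/
theorem mem_or_of_indep {A B : Set (Fin p)} {x y : Fin p}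
    (hA : ∀ x ∈ A, ∀ y ∈ A, ¬ Γ.Adj x y) (hB : ∀ x ∈ B, ∀ y ∈ B, ¬ Γ.Adj x y)
    (hx : x ∈ symmDiff A B) (hy : y ∈ symmDiff A B) (h : Γ.Adj x y) : x ∈ A ↔ y ∉ A := by
  rw [Set.mem_symmDiff] at hx hy
  have h1 := fun hx hy => hA x hx y hy h
  have h2 := fun hx hy => hB x hx y hy h
  tauto

theorem isPolytopeEdge_of_isLinked (hΓ : IsCircular Γ) {G H : DAG p} (hG : G.skeleton = Γ)
    (hH : H.skeleton = Γ) (hne : G.colliders ≠ H.colliders)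
    (hU : IsLinked Γ (symmDiff G.colliders H.colliders)) :
    IsPolytopeEdge (CIM Γ) (convexHull ℝ {G.imset, H.imset}) := by
  classical
  set A := G.colliders with hAdef
  set B := H.colliders with hBdef
  set U := symmDiff A B with hUdef
  have hA : ∀ x ∈ A, ∀ y ∈ A, ¬ Γ.Adj x y :=
    fun x hx y hy => hG ▸ DAG.colliders_indep (hG ▸ hΓ) hx hy
  have hB : ∀ x ∈ B, ∀ y ∈ B, ¬ Γ.Adj x y :=
    fun x hx y hy => hH ▸ DAG.colliders_indep (hH ▸ hΓ) hx hy
  -- An edge inside `U` contributes at most 1, with equality when exactly one end is a collider. The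
  -- terms `u` force common colliders to stay and exclude nodes outside `A ∪ B`. `E` and `W` are the
  -- termwise maxima, and both `A` and `B` attain all of them.
  let e : Fin p × Fin p → ImsetSpace p →L[ℝ] ℝ := fun z =>
    if z.1 ∈ U ∧ z.2 ∈ U ∧ Γ.Adj z.1 z.2 then colliderCoord Γ z.1 + colliderCoord Γ z.2 else 0
  let u : Fin p → ImsetSpace p →L[ℝ] ℝ := fun x =>
    if x ∈ A ∩ B then colliderCoord Γ x else if x ∈ A ∪ B then 0 else -colliderCoord Γ x
  let E : Fin p × Fin p → ℝ := fun z => if z.1 ∈ U ∧ z.2 ∈ U ∧ Γ.Adj z.1 z.2 then 1 else 0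
  let W : Fin p → ℝ := fun x => if x ∈ A ∩ B then 1 else 0
  let l : ImsetSpace p →L[ℝ] ℝ := ∑ z, e z + ∑ x, u x
  have hl : ∀ v, l v = ∑ z, e z v + ∑ x, u x v := by
    intro v; simp [l]
  have he : ∀ D : DAG p, D.skeleton = Γ → ∀ z, e z D.imset ≤ E z := by
    intro D hD z
    have hi : z.1 ∈ D.colliders → z.2 ∈ D.colliders → ¬ Γ.Adj z.1 z.2 :=
      fun hx hy => hD ▸ DAG.colliders_indep (hD ▸ hΓ) hx hy
    by_cases hz : z.1 ∈ U ∧ z.2 ∈ U ∧ Γ.Adj z.1 z.2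
    · simp only [e, E, if_pos hz, add_apply, colliderCoord_imset hΓ hD]
      split_ifs with h1 h2 h2
      · exact absurd hz.2.2 (hi h1 h2)
      all_goals norm_num
    · simp [e, E, if_neg hz]
  have heq : ∀ D : DAG p, D.skeleton = Γ → ∀ z, (e z D.imset = E z ↔
      (z.1 ∈ U → z.2 ∈ U → Γ.Adj z.1 z.2 → (z.1 ∈ D.colliders ↔ z.2 ∉ D.colliders))) := by
    intro D hD z
    by_cases hz : z.1 ∈ U ∧ z.2 ∈ U ∧ Γ.Adj z.1 z.2
    · simp only [e, E, if_pos hz, add_apply, colliderCoord_imset hΓ hD]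
      split_ifs with h1 h2 h2 <;> simp [hz, h1, h2]
    · simp only [e, E, if_neg hz, zero_apply, true_iff]
      tauto
  have hu : ∀ D : DAG p, D.skeleton = Γ → ∀ x, u x D.imset ≤ W x := by
    intro D hD x
    simp only [u, W]
    split_ifs
    · rw [colliderCoord_imset hΓ hD]; split_ifs <;> norm_num
    · simp
    · rw [neg_apply, colliderCoord_imset hΓ hD]; split_ifs <;> norm_num
  have hueq : ∀ D : DAG p, D.skeleton = Γ → ∀ x, (u x D.imset = W x ↔
      ((x ∈ A ∩ B → x ∈ D.colliders) ∧ (x ∉ A ∪ B → x ∉ D.colliders))) := by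
    intro D hD x
    simp only [u, W]
    split_ifs with h1 h2
    · have : x ∈ A ∪ B := .inl h1.1
      rw [colliderCoord_imset hΓ hD]
      split_ifs with h3
      · exact iff_of_true rfl ⟨fun _ => h3, fun h => absurd this h⟩
      · exact iff_of_false (by norm_num) fun h => h3 (h.1 h1)
    · exact iff_of_true (by simp) ⟨fun h => absurd h h1, fun h => absurd h2 h⟩
    · rw [neg_apply, colliderCoord_imset hΓ hD]
      split_ifs with h3
      · exact iff_of_false (by norm_num) fun h => h.2 h2 h3
      · exact iff_of_true (by norm_num) ⟨fun h => absurd h h1, fun _ => h3⟩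
  have hle : ∀ D : DAG p, D.skeleton = Γ → l D.imset ≤ ∑ z, E z + ∑ x, W x := by
    intro D hD
    rw [hl]
    exact add_le_add (Finset.sum_le_sum fun z _ => he D hD z)
      (Finset.sum_le_sum fun x _ => hu D hD x)
  have hlG : l G.imset = ∑ z, E z + ∑ x, W x := by
    rw [hl]
    refine congrArg₂ _ (Finset.sum_congr rfl fun z _ => (heq G hG z).2 ?_)
      (Finset.sum_congr rfl fun x _ => (hueq G hG x).2 ⟨fun h => h.1, fun h h' => h (.inl h')⟩)
    exact fun h1 h2 h => mem_or_of_indep hA hB h1 h2 h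
  have hlH : l H.imset = ∑ z, E z + ∑ x, W x := by
    rw [hl]
    refine congrArg₂ _ (Finset.sum_congr rfl fun z _ => (heq H hH z).2 ?_)
      (Finset.sum_congr rfl fun x _ => (hueq H hH x).2 ⟨fun h => h.2, fun h h' => h (.inr h')⟩)
    exact fun h1 h2 h => mem_or_of_indep hB hA (symmDiff_comm A B ▸ h1) (symmDiff_comm A B ▸ h2) h
  refine isPolytopeEdge_of_isMaxOn ⟨G, hG, rfl⟩ ⟨H, hH, rfl⟩
    (fun h => hne (DAG.colliders_eq_of_imset_eq hΓ hG hH h)) l (hlG.trans hlH.symm) ?_ ?_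
  · rintro _ ⟨D, hD, rfl⟩
    rw [hlG]; exact hle D hD
  · rintro _ ⟨D, hD, rfl⟩ hmax
    rw [hlG, hl] at hmax
    have hs1 := Finset.sum_le_sum fun z (_ : z ∈ Finset.univ) => he D hD z
    have hs2 := Finset.sum_le_sum fun x (_ : x ∈ Finset.univ) => hu D hD x
    -- A maximizer of the sum attains every termwise bound.
    have q1 := (Finset.sum_eq_sum_iff_of_le fun z _ => he D hD z).1 (by linarith)
    have q2 := (Finset.sum_eq_sum_iff_of_le fun x _ => hu D hD x).1 (by linarith)
    have r1 := fun x y => (heq D hD (x, y)).1 (q1 (x, y) (Finset.mem_univ _))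
    have r2 := fun x => (hueq D hD x).1 (q2 x (Finset.mem_univ _))
    -- Both `D.colliders` and `A` alternate along edges of `U`, so agreement between them
    -- propagates. By linkedness they agree on all of `U` or nowhere on it; in the latter case
    -- `D.colliders` is `B`.
    have hstep : ∀ x ∈ U, ∀ y ∈ U, Γ.Adj x y →
        ((x ∈ D.colliders ↔ x ∈ A) ↔ (y ∈ D.colliders ↔ y ∈ A)) := by
      intro x hx y hy hxy
      have h1 := r1 x y hx hy hxy
      have h2 := mem_or_of_indep hA hB hx hy hxy
      tauto
    by_cases hex : ∃ x ∈ U, (x ∈ D.colliders ↔ x ∈ A)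
    · left
      obtain ⟨x, hx, hxA⟩ := hex
      have hall := hU {x | x ∈ D.colliders ↔ x ∈ A}
        (fun x hx y hy hxy => (hstep x hx y hy hxy).1) x hx hxA
      refine DAG.imset_eq_of_colliders_eq hΓ hD hG ?_
      ext y
      by_cases hy : y ∈ U
      · exact hall hy
      · have := r2 y
        rw [hUdef, Set.mem_symmDiff] at hy
        simp only [Set.mem_inter_iff, Set.mem_union] at this
        change _ ↔ y ∈ A
        tauto
    · right
      refine DAG.imset_eq_of_colliders_eq hΓ hD hH ?_
      ext y
      change _ ↔ y ∈ B
      have := r2 y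
      simp only [Set.mem_inter_iff, Set.mem_union] at this
      by_cases hy : y ∈ U
      · have h3 : ¬ (y ∈ D.colliders ↔ y ∈ A) := fun h => hex ⟨y, hy, h⟩
        rw [hUdef, Set.mem_symmDiff] at hy
        tauto
      · rw [hUdef, Set.mem_symmDiff] at hy
        tauto

/-- If every DAG with skeleton `Γ` has a collider, then two DAGs with one collider each span an
edge. -/
theorem isPolytopeEdge_of_singletons (hΓ : IsCircular Γ) {G H : DAG p} (hG : G.skeleton = Γ)
    (hH : H.skeleton = Γ) {a b : Fin p} (hab : a ≠ b) (ha : G.colliders = {a})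
    (hb : H.colliders = {b}) (hnon : ∀ D : DAG p, D.skeleton = Γ → D.colliders.Nonempty) :
    IsPolytopeEdge (CIM Γ) (convexHull ℝ {G.imset, H.imset}) := by
  classical
  -- All weights are negative and some collider is always present, so the maximum -1 is attained
  -- only by a single collider at `a` or `b`.
  let w : Fin p → ℝ := fun x => if x = a ∨ x = b then -1 else -2
  have hwle : ∀ x, w x ≤ -1 := by
    intro x; simp only [w]; split_ifs <;> norm_num
  let l : ImsetSpace p →L[ℝ] ℝ := ∑ x, w x • colliderCoord Γ x
  have hl : ∀ D : DAG p, D.skeleton = Γ →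
      l D.imset = ∑ x, if x ∈ D.colliders then w x else 0 := by
    intro D hD
    simp [l, colliderCoord_imset hΓ hD]
  have hsplit : ∀ D : DAG p, D.skeleton = Γ → ∀ x ∈ D.colliders, l D.imset =
      w x + ∑ y ∈ Finset.univ.erase x, if y ∈ D.colliders then w y else 0 := by
    intro D hD x hx
    rw [hl D hD, ← Finset.add_sum_erase _ _ (Finset.mem_univ x), if_pos hx]
  have hterm : ∀ (D : DAG p) y, (if y ∈ D.colliders then w y else 0) ≤ 0 := by
    intro D y
    split_ifs
    · have := hwle y; linarith
    · exact le_rfl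
  have hlG : l G.imset = -1 := by rw [hl G hG, ha]; simp [w]
  have hlH : l H.imset = -1 := by rw [hl H hH, hb]; simp [w]
  have hne : G.imset ≠ H.imset := by
    intro h
    have := DAG.colliders_eq_of_imset_eq hΓ hG hH h
    rw [ha, hb] at this
    exact hab (Set.singleton_injective this)
  refine isPolytopeEdge_of_isMaxOn ⟨G, hG, rfl⟩ ⟨H, hH, rfl⟩ hne l (hlG.trans hlH.symm) ?_ ?_
  · rintro _ ⟨D, hD, rfl⟩
    obtain ⟨x, hx⟩ := hnon D hD
    rw [hlG, hsplit D hD x hx]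
    have := Finset.sum_nonpos fun y (_ : y ∈ Finset.univ.erase x) => hterm D y
    have := hwle x
    linarith
  · rintro _ ⟨D, hD, rfl⟩ hmax
    obtain ⟨x, hx⟩ := hnon D hD
    rw [hlG, hsplit D hD x hx] at hmax
    have h1 := Finset.sum_nonpos fun y (_ : y ∈ Finset.univ.erase x) => hterm D y
    have h2 := hwle x
    have h3 := (Finset.sum_eq_zero_iff_of_nonpos
      fun y (_ : y ∈ Finset.univ.erase x) => hterm D y).1 (by linarith)
    have hDx : D.colliders = {x} := by
      ext y
      constructor
      · intro hy
        by_contra hyx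
        have := h3 y (Finset.mem_erase.2 ⟨hyx, Finset.mem_univ _⟩)
        rw [if_pos hy] at this
        have := hwle y
        linarith
      · rintro rfl; exact hx
    have hx1 : x = a ∨ x = b := by
      by_contra hc
      have : w x = -2 := by simp only [w, if_neg hc]
      linarith
    rcases hx1 with rfl | rfl
    · exact .inl (DAG.imset_eq_of_colliders_eq hΓ hD hG (hDx.trans ha.symm))
    · exact .inr (DAG.imset_eq_of_colliders_eq hΓ hD hH (hDx.trans hb.symm))

/-- An edge does not allow exchanging a proper part of the symmetric difference. -/
theorem IsPolytopeEdge.exchange (hΓ : IsCircular Γ) {G H : DAG p} (hG : G.skeleton = Γ)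
    (hH : H.skeleton = Γ) (h : IsPolytopeEdge (CIM Γ) (convexHull ℝ {G.imset, H.imset}))
    {C : Set (Fin p)} (hC : C ⊆ symmDiff G.colliders H.colliders) {D E : DAG p}
    (hD : D.skeleton = Γ) (hE : E.skeleton = Γ) (hDC : D.colliders = symmDiff G.colliders C)
    (hEC : E.colliders = symmDiff H.colliders C) :
    C = ∅ ∨ C = symmDiff G.colliders H.colliders := by
  classical
  have hadd : D.imset + E.imset = G.imset + H.imset := by
    ext S
    simp only [Pi.add_apply]
    by_cases hS : Γ.IsClique (S.1 : Set (Fin p))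
    · simp only [DAG.imset_of_isClique hD S hS, DAG.imset_of_isClique hE S hS,
        DAG.imset_of_isClique hG S hS, DAG.imset_of_isClique hH S hS]
    by_cases hx : ∃ x, IsInner Γ x ∧ window x = S.1
    · obtain ⟨x, hx, hxS⟩ := hx
      obtain ⟨S, hS2⟩ := S
      simp only at hxS
      subst hxS
      rw [DAG.imset_window hΓ hD hx, DAG.imset_window hΓ hE hx, DAG.imset_window hΓ hG hx,
        DAG.imset_window hΓ hH hx, hDC, hEC]
      have := @hC x
      simp only [Set.mem_symmDiff] at this ⊢
      by_cases h1 : x ∈ G.colliders <;> by_cases h2 : x ∈ H.colliders <;>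
        by_cases h3 : x ∈ C <;> simp_all
    · have h0 : ∀ F : DAG p, F.skeleton = Γ → F.imset S = 0 := by
        intro F hF
        rw [DAG.imset_of_not_isClique hΓ hF S hS, if_neg]
        rintro ⟨x, hxF, hxS⟩
        exact hx ⟨x, DAG.isInner_of_mem_colliders hF hxF, hxS⟩
      rw [h0 D hD, h0 E hE, h0 G hG, h0 H hH]
  have := h.eq_or_eq_of_add_eq (by rintro _ ⟨F, -, rfl⟩; exact F.imset_eq_zero_or_one)
    ⟨G, hG, rfl⟩ ⟨H, hH, rfl⟩ ⟨D, hD, rfl⟩ ⟨E, hE, rfl⟩ hadd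
  rcases this with h | h
  · left
    have := DAG.colliders_eq_of_imset_eq hΓ hD hG h
    rw [hDC] at this
    simpa using this
  · right
    have := DAG.colliders_eq_of_imset_eq hΓ hD hH h
    rw [hDC] at this
    rw [← this, symmDiff_symmDiff_cancel_left]

/-- Passing to `symmDiff A C` replaces `A` by `B` on a union `C` of components of `symmDiff A B`. An
edge between a kept node of `A` and a new node of `B` would lie inside `symmDiff A B` and leave `C`.
-/
theorem indep_symmDiff {A B C : Set (Fin p)} (hA : ∀ x ∈ A, ∀ y ∈ A, ¬ Γ.Adj x y)
    (hB : ∀ x ∈ B, ∀ y ∈ B, ¬ Γ.Adj x y) (hCU : C ⊆ symmDiff A B)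
    (hC : ∀ x ∈ symmDiff A B, ∀ y ∈ symmDiff A B, Γ.Adj x y → x ∈ C → y ∈ C) :
    ∀ x ∈ symmDiff A C, ∀ y ∈ symmDiff A C, ¬ Γ.Adj x y := by
  have key : ∀ x ∈ A, x ∉ C → ∀ y ∈ C, y ∉ A → ¬ Γ.Adj x y := by
    intro x hx hxC y hy hyA hxy
    have hyU := hCU hy
    have hyB : y ∈ B := hyU.resolve_left (fun h => hyA h.1) |>.1
    exact hxC (hC y hyU x (.inl ⟨hx, fun hxB => hB x hxB y hyB hxy⟩) hxy.symm hy)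
  have hCB : ∀ x ∈ C, x ∉ A → x ∈ B := fun x hx hxA =>
    ((hCU hx).resolve_left (fun h => hxA h.1)).1
  rintro x (⟨hx, hxC⟩ | ⟨hx, hxA⟩) y (⟨hy, hyC⟩ | ⟨hy, hyA⟩) hxy
  · exact hA x hx y hy hxy
  · exact key x hx hxC y hy hyA hxy
  · exact key y hy hyC x hx hxA hxy.symm
  · exact hB x (hCB x hx hxA) y (hCB y hy hyA) hxy

end EdgeCriterion

/-! ### Necessity of connectedness, and connected sets as runs -/

section Runs

variable {p : ℕ} [NeZero p] {Γ : SimpleGraph (Fin p)}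

/-- Necessity: let `Γ` be such that all sets of pairwise non-adjacent inner nodes, the empty set
possibly excepted, are collider sets. Then the colliders in which the two ends of an edge differ
induce a connected subgraph, or both ends have one collider. -/
theorem IsPolytopeEdge.isLinked_or_singletons (hΓ : IsCircular Γ) {G H : DAG p}
    (hG : G.skeleton = Γ) (hH : H.skeleton = Γ) (e : Prop)
    (hreal : ∀ A : Set (Fin p), (∀ x ∈ A, IsInner Γ x) → (∀ x ∈ A, ∀ y ∈ A, ¬ Γ.Adj x y) →
      (A.Nonempty ∨ e) → ∃ D : DAG p, D.skeleton = Γ ∧ D.colliders = A)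
    (hGe : G.colliders.Nonempty ∨ e) (hHe : H.colliders.Nonempty ∨ e)
    (h : IsPolytopeEdge (CIM Γ) (convexHull ℝ {G.imset, H.imset})) :
    IsLinked Γ (symmDiff G.colliders H.colliders) ∨
      ¬ e ∧ ∃ a b, a ≠ b ∧ G.colliders = {a} ∧ H.colliders = {b} := by
  have hA : ∀ x ∈ G.colliders, ∀ y ∈ G.colliders, ¬ Γ.Adj x y :=
    fun x hx y hy => hG ▸ DAG.colliders_indep (hG ▸ hΓ) hx hy
  have hB : ∀ x ∈ H.colliders, ∀ y ∈ H.colliders, ¬ Γ.Adj x y :=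
    fun x hx y hy => hH ▸ DAG.colliders_indep (hH ▸ hΓ) hx hy
  have hAI : ∀ x ∈ G.colliders, IsInner Γ x := fun x => DAG.isInner_of_mem_colliders hG
  have hBI : ∀ x ∈ H.colliders, IsInner Γ x := fun x => DAG.isInner_of_mem_colliders hH
  set A := G.colliders with hAdef
  set B := H.colliders with hBdef
  -- `e` says that the empty set is also a collider set. Apart from emptiness of an exchanged set,
  -- nothing prevents swapping a union of components.
  have hswap : ∀ C ⊆ symmDiff A B,
      (∀ x ∈ symmDiff A B, ∀ y ∈ symmDiff A B, Γ.Adj x y → x ∈ C → y ∈ C) →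
      ((symmDiff A C).Nonempty ∨ e) → ((symmDiff B C).Nonempty ∨ e) →
      C = ∅ ∨ C = symmDiff A B := by
    intro C hC hcl h1 h2
    have hCI : ∀ x ∈ C, IsInner Γ x := fun x hx => (hC hx).elim (fun h => hAI x h.1)
      fun h => hBI x h.1
    obtain ⟨D, hD, hDC⟩ := hreal _ (fun x hx => hx.elim (fun h => hAI x h.1) fun h => hCI x h.1)
      (indep_symmDiff hA hB hC hcl) h1
    obtain ⟨E, hE, hEC⟩ := hreal _ (fun x hx => hx.elim (fun h => hBI x h.1) fun h => hCI x h.1)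
      (indep_symmDiff hB hA (symmDiff_comm A B ▸ hC) (symmDiff_comm A B ▸ hcl)) h2
    exact h.exchange hΓ hG hH hC hD hE hDC hEC
  by_contra hcon
  rw [not_or] at hcon
  obtain ⟨hlink, hsing⟩ := hcon
  unfold IsLinked at hlink
  push Not at hlink
  obtain ⟨P, hP, x, hxU, hxP, hUP⟩ := hlink
  set U := symmDiff A B with hUdef
  have hne : U ∩ P ≠ ∅ := Set.nonempty_iff_ne_empty.1 ⟨x, hxU, hxP⟩
  have hneU : U ∩ P ≠ U := fun h => hUP (Set.inter_eq_left.1 h)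
  have hcl : ∀ x ∈ U, ∀ y ∈ U, Γ.Adj x y → x ∈ U ∩ P → y ∈ U ∩ P :=
    fun x hx y hy hxy hxP => ⟨hy, hP x hx y hy hxy hxP.2⟩
  have hnot : ¬ (((symmDiff A (U ∩ P)).Nonempty ∨ e) ∧ ((symmDiff B (U ∩ P)).Nonempty ∨ e)) :=
    fun h => (hswap _ Set.inter_subset_left hcl h.1 h.2).elim hne hneU
  have he : ¬ e := fun he => hnot ⟨.inr he, .inr he⟩
  -- The swap of `U ∩ P` can fail only by emptying `A` or `B`.
  have hAB : A = U ∩ P ∨ B = U ∩ P := by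
    by_contra hc
    rw [not_or] at hc
    refine hnot ⟨.inl ?_, .inl ?_⟩ <;> rw [Set.nonempty_iff_ne_empty]
    · exact fun h => hc.1 (symmDiff_eq_bot.1 h)
    · exact fun h => hc.2 (symmDiff_eq_bot.1 h)
  have hdisj : ∀ x ∈ A, x ∉ B := by
    intro x hxA hxB
    have : x ∈ U := by
      rcases hAB with h | h
      · exact (h ▸ hxA : x ∈ U ∩ P).1
      · exact (h ▸ hxB : x ∈ U ∩ P).1
    rcases this with h | h
    exacts [h.2 hxB, h.2 hxA]
  -- One of `A`, `B` is now closed under adjacency in `U`, whereas membership in it alternates along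
  -- edges of `U`; hence there are no such edges, and every single node of `U` may be swapped.
  have hindep : ∀ x ∈ U, ∀ y ∈ U, ¬ Γ.Adj x y := by
    intro x hx y hy hxy
    have h1 := mem_or_of_indep hA hB hx hy hxy
    have h2 := hcl x hx y hy hxy
    have h3 := hcl y hy x hx hxy.symm
    have h4 := mem_or_of_indep hB hA (symmDiff_comm A B ▸ hx) (symmDiff_comm A B ▸ hy) hxy
    have hno : ∀ Q : Set (Fin p), (x ∈ Q ↔ y ∉ Q) → (x ∈ Q → y ∈ Q) → (y ∈ Q → x ∈ Q) → False := by
      intro Q h h2 h3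
      by_cases hx : x ∈ Q
      · exact h.1 hx (h2 hx)
      · exact hx (h.2 fun hy => hx (h3 hy))
    rcases hAB with h | h <;> rw [← h] at h2 h3
    · exact hno A h1 h2 h3
    · exact hno B h4 h2 h3
  have hAnon : A.Nonempty := hGe.resolve_right he
  have hBnon : B.Nonempty := hHe.resolve_right he
  have hU1 : ∀ c c', c ∈ U → c' ∈ U → c' ≠ c → ¬ ((symmDiff A {c}).Nonempty ∧
      (symmDiff B {c}).Nonempty) := by
    intro c c' hc hc' hcc' h
    rcases hswap {c} (by simpa using hc) (fun x hx y hy hxy => absurd hxy (hindep x hx y hy))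
      (.inl h.1) (.inl h.2) with h | h
    · exact Set.singleton_ne_empty _ h
    · rw [← h] at hc'
      exact hcc' hc'
  have hmemA : ∀ x ∈ A, x ∈ U := fun x hx => .inl ⟨hx, hdisj x hx⟩
  have hmemB : ∀ x ∈ B, x ∈ U := fun x hx => .inr ⟨hx, fun h => hdisj x h hx⟩
  -- If one set has two elements, moving one of them to the other set empties neither, which `hU1`
  -- forbids.
  rcases hAnon.exists_eq_singleton_or_nontrivial with ⟨a, ha⟩ | ⟨a, ha, a', ha', hne'⟩
  · rcases hBnon.exists_eq_singleton_or_nontrivial with ⟨b, hb⟩ | ⟨b, hb, b', hb', hne'⟩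
    · refine hsing ⟨he, a, b, ?_, ha, hb⟩
      rintro rfl
      exact hdisj a (ha ▸ rfl) (hb ▸ rfl)
    · exact hU1 b b' (hmemB b hb) (hmemB b' hb') hne'.symm
        ⟨⟨b, .inr ⟨rfl, fun h => hdisj b h hb⟩⟩, ⟨b', .inl ⟨hb', hne'.symm⟩⟩⟩
  · exact hU1 a a' (hmemA a ha) (hmemA a' ha') hne'.symm
      ⟨⟨a', .inl ⟨ha', hne'.symm⟩⟩, ⟨a, .inr ⟨rfl, hdisj a ha⟩⟩⟩

/-- A run may go round in either direction; the triple is the same set in both. -/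
theorem RunsAlong.isInner (hΓ : IsCircular Γ) {n : ℕ} {π : ℕ → Fin p} (hπ : RunsAlong Γ n π)
    {j : ℕ} (hj : j + 1 < n) : IsInner Γ (π (j + 1)) ∧ triple π (j + 1) = window (π (j + 1)) := by
  have h1 := hπ.adj j (by omega)
  have h2 := (hπ.adj (j + 1) hj).symm
  obtain ⟨hne, hn⟩ := hπ.induced j (by omega)
  have e1 := hΓ.eq_of_adj h1
  have e2 := hΓ.eq_of_adj h2
  simp only [triple, window, Nat.add_sub_cancel]
  change π (j + 1 + 1) = _ ∨ π (j + 1 + 1) = _ at e2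
  rcases e1 with e1 | e1 <;> rcases e2 with e2 | e2
  · exact absurd (e1.trans e2.symm) hne
  · rw [e1] at h1 hne hn ⊢
    change _ ≠ π (j + 1 + 1) at hne
    change ¬ Γ.Adj _ (π (j + 1 + 1)) at hn
    rw [e2] at h2 hne hn ⊢
    exact ⟨⟨hne, hn, h1, h2⟩, rfl⟩
  · rw [e1] at h1 hne hn ⊢
    change _ ≠ π (j + 1 + 1) at hne
    change ¬ Γ.Adj _ (π (j + 1 + 1)) at hn
    rw [e2] at h2 hne hn ⊢
    refine ⟨⟨hne.symm, fun h => hn h.symm, h2, h1⟩, ?_⟩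
    ext z
    simp only [Finset.mem_insert, Finset.mem_singleton]
    tauto
  · exact absurd (e1.trans e2.symm) hne

theorem sum_basisVec_apply (F : Finset (Finset (Fin p))) (S : {S : Finset (Fin p) // 2 ≤ S.card}) :
    (∑ T ∈ F, basisVec T) S = if S.1 ∈ F then 1 else 0 := by
  rw [Finset.sum_apply]
  simp [basisVec]

theorem mem_oddTriples {π : ℕ → Fin p} {m : ℕ} {S : Finset (Fin p)} :
    S ∈ oddTriples π m ↔ ∃ t < m, triple π (2 * t + 1) = S := by
  simp [oddTriples]

theorem mem_evenTriples {π : ℕ → Fin p} {m : ℕ} {S : Finset (Fin p)} :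
    S ∈ evenTriples π m ↔ ∃ t < m, triple π (2 * t + 2) = S := by
  simp [evenTriples]

/-- The common form of shifts (`m' = m`) and splits (`m' + 1 = m`). -/
theorem RunsAlong.imset_sub_eq_iff (hΓ : IsCircular Γ) {G H : DAG p} (hG : G.skeleton = Γ)
    (hH : H.skeleton = Γ) {m m' : ℕ} (hm : m' = m ∨ m' + 1 = m) {π : ℕ → Fin p}
    (hπ : RunsAlong Γ (m + m' + 1) π) :
    H.imset - ∑ S ∈ oddTriples π m, basisVec S = G.imset - ∑ S ∈ evenTriples π m', basisVec S ↔
      (∀ t < m, π (2 * t + 1) ∈ H.colliders ∧ π (2 * t + 1) ∉ G.colliders) ∧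
      (∀ t < m', π (2 * t + 2) ∈ G.colliders ∧ π (2 * t + 2) ∉ H.colliders) ∧
      ∀ x ∈ symmDiff G.colliders H.colliders, ∃ j, 0 < j ∧ j < m + m' + 1 ∧ x = π j := by
  classical
  have hodd : ∀ t < m, IsInner Γ (π (2 * t + 1)) ∧
      triple π (2 * t + 1) = window (π (2 * t + 1)) := fun t ht => hπ.isInner hΓ (by omega)
  have heven : ∀ t < m', IsInner Γ (π (2 * t + 2)) ∧
      triple π (2 * t + 2) = window (π (2 * t + 2)) :=
    fun t ht => hπ.isInner hΓ (j := 2 * t + 1) (by omega)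
  have hwo : ∀ x, IsInner Γ x →
      (window x ∈ oddTriples π m ↔ ∃ t < m, x = π (2 * t + 1)) := by
    intro x hx
    rw [mem_oddTriples]
    refine exists_congr fun t => and_congr_right fun ht => ?_
    rw [(hodd t ht).2]
    exact ⟨fun h => (IsInner.window_injective (hodd t ht).1 hx h).symm, fun h => h ▸ rfl⟩
  have hwe : ∀ x, IsInner Γ x →
      (window x ∈ evenTriples π m' ↔ ∃ t < m', x = π (2 * t + 2)) := by
    intro x hx
    rw [mem_evenTriples]
    refine exists_congr fun t => and_congr_right fun ht => ?_
    rw [(heven t ht).2]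
    exact ⟨fun h => (IsInner.window_injective (heven t ht).1 hx h).symm, fun h => h ▸ rfl⟩
  -- Injectivity on the inner nodes keeps odd and even centres apart, so that no two basis vectors
  -- cancel.
  have hdisj : ∀ x, (∃ t < m, x = π (2 * t + 1)) → ¬ ∃ t < m', x = π (2 * t + 2) := by
    rintro x ⟨t, ht, rfl⟩ ⟨s, hs, h⟩
    have := hπ.inner_injOn (x₁ := 2 * t + 1) (x₂ := 2 * s + 2) ⟨by omega, by omega⟩
      ⟨by omega, by omega⟩ h
    omega
  have hinner : ∀ x, (∃ j, 0 < j ∧ j < m + m' + 1 ∧ x = π j) ↔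
      (∃ t < m, x = π (2 * t + 1)) ∨ ∃ t < m', x = π (2 * t + 2) := by
    intro x
    constructor
    · rintro ⟨j, h0, hj, rfl⟩
      rcases Nat.even_or_odd' j with ⟨k, rfl | rfl⟩
      · right
        exact ⟨k - 1, by omega, by congr 1; omega⟩
      · left
        exact ⟨k, by omega, rfl⟩
    · rintro (⟨t, ht, rfl⟩ | ⟨t, ht, rfl⟩)
      · exact ⟨_, by omega, by omega, rfl⟩
      · exact ⟨_, by omega, by omega, rfl⟩
  have hpt : ∀ x (hx : IsInner Γ x), ((H.imset - ∑ S ∈ oddTriples π m, basisVec S)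
      ⟨window x, hx.two_le_card_window⟩ =
      (G.imset - ∑ S ∈ evenTriples π m', basisVec S)
      ⟨window x, hx.two_le_card_window⟩ ↔
      ((∃ t < m, x = π (2 * t + 1)) → x ∈ H.colliders ∧ x ∉ G.colliders) ∧
      ((∃ t < m', x = π (2 * t + 2)) → x ∈ G.colliders ∧ x ∉ H.colliders) ∧
      (x ∈ symmDiff G.colliders H.colliders →
        (∃ t < m, x = π (2 * t + 1)) ∨ ∃ t < m', x = π (2 * t + 2))) := by
    intro x hx
    have hd := hdisj x
    rw [Pi.sub_apply, Pi.sub_apply, sum_basisVec_apply, sum_basisVec_apply,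
      DAG.imset_window hΓ hG hx, DAG.imset_window hΓ hH hx]
    simp only [hwo x hx, hwe x hx, Set.mem_symmDiff]
    by_cases h1 : ∃ t < m, x = π (2 * t + 1) <;> by_cases h2 : ∃ t < m', x = π (2 * t + 2) <;>
      by_cases h3 : x ∈ G.colliders <;> by_cases h4 : x ∈ H.colliders <;>
      simp only [h1, h2, h3, h4, if_true, if_false] <;> norm_num
    all_goals exact absurd h2 (hd h1)
  constructor
  · intro h
    refine ⟨fun t ht => ?_, fun t ht => ?_, fun x hx => ?_⟩
    · exact ((hpt _ (hodd t ht).1).1 (congrFun h _)).1 ⟨t, ht, rfl⟩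
    · exact ((hpt _ (heven t ht).1).1 (congrFun h _)).2.1 ⟨t, ht, rfl⟩
    · have hxI : IsInner Γ x := hx.elim (fun h => DAG.isInner_of_mem_colliders hG h.1)
        fun h => DAG.isInner_of_mem_colliders hH h.1
      exact (hinner x).2 (((hpt x hxI).1 (congrFun h _)).2.2 hx)
  · rintro ⟨h1, h2, h3⟩
    ext S
    by_cases hx : ∃ x, IsInner Γ x ∧ window x = S.1
    · obtain ⟨x, hx, hxS⟩ := hx
      obtain ⟨S, hS2⟩ := S
      simp only at hxS
      subst hxS
      refine (hpt x hx).2 ⟨?_, ?_, fun h => (hinner x).1 (h3 x h)⟩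
      · rintro ⟨t, ht, rfl⟩; exact h1 t ht
      · rintro ⟨t, ht, rfl⟩; exact h2 t ht
    -- Away from windows of inner nodes, both imsets agree and no triple of the run occurs.
    · rw [Pi.sub_apply, Pi.sub_apply, sum_basisVec_apply, sum_basisVec_apply, if_neg, if_neg]
      · congr 1
        by_cases hS : Γ.IsClique (S.1 : Set (Fin p))
        · rw [DAG.imset_of_isClique hG S hS, DAG.imset_of_isClique hH S hS]
        · rw [DAG.imset_of_not_isClique hΓ hG S hS, DAG.imset_of_not_isClique hΓ hH S hS,
            if_neg, if_neg]
          · rintro ⟨x, hxF, hxS⟩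
            exact hx ⟨x, DAG.isInner_of_mem_colliders hG hxF, hxS⟩
          · rintro ⟨x, hxF, hxS⟩
            exact hx ⟨x, DAG.isInner_of_mem_colliders hH hxF, hxS⟩
      · rw [mem_evenTriples]
        rintro ⟨t, ht, h⟩
        exact hx ⟨_, (heven t ht).1, (heven t ht).2 ▸ h⟩
      · rw [mem_oddTriples]
        rintro ⟨t, ht, h⟩
        exact hx ⟨_, (hodd t ht).1, (hodd t ht).2 ▸ h⟩

theorem RunsAlong.isLinked {n : ℕ} {π : ℕ → Fin p} (hπ : RunsAlong Γ n π) {U : Set (Fin p)}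
    (hU : ∀ x, x ∈ U ↔ ∃ j, 0 < j ∧ j < n ∧ x = π j) : IsLinked Γ U := by
  rintro P hP x hx hxP y hy
  obtain ⟨i, hi0, hin, rfl⟩ := (hU x).1 hx
  obtain ⟨j, hj0, hjn, rfl⟩ := (hU y).1 hy
  have hstep : ∀ k, 0 < k → k + 1 < n → (π k ∈ P ↔ π (k + 1) ∈ P) := by
    intro k hk hkn
    have h1 : π k ∈ U := (hU _).2 ⟨k, hk, by omega, rfl⟩
    have h2 : π (k + 1) ∈ U := (hU _).2 ⟨k + 1, by omega, hkn, rfl⟩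
    have h := hπ.adj k (by omega)
    exact ⟨hP _ h1 _ h2 h, hP _ h2 _ h1 h.symm⟩
  have hall : ∀ k, k + 1 < n → (π (k + 1) ∈ P ↔ π 1 ∈ P) := by
    intro k
    induction k with
    | zero => simp
    | succ k ih => exact fun hk => (hstep _ (by omega) hk).symm.trans (ih (by omega))
  obtain ⟨i, rfl⟩ := Nat.exists_eq_add_of_lt hi0
  obtain ⟨j, rfl⟩ := Nat.exists_eq_add_of_lt hj0
  simp only [Nat.zero_add] at *
  exact (hall j hjn).2 ((hall i hin).1 hxP)

theorem RunsAlong.isLinked_of_imset_sub_eq (hΓ : IsCircular Γ) {G H : DAG p}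
    (hG : G.skeleton = Γ) (hH : H.skeleton = Γ) {m m' : ℕ} (h1 : 1 ≤ m)
    (hm : m' = m ∨ m' + 1 = m) {π : ℕ → Fin p} (hπ : RunsAlong Γ (m + m' + 1) π)
    (h : H.imset - ∑ S ∈ oddTriples π m, basisVec S =
      G.imset - ∑ S ∈ evenTriples π m', basisVec S) :
    G.colliders ≠ H.colliders ∧ IsLinked Γ (symmDiff G.colliders H.colliders) := by
  obtain ⟨ho, he, hU⟩ := (hπ.imset_sub_eq_iff hΓ hG hH hm).1 h
  refine ⟨fun h => (ho 0 h1).2 (h ▸ (ho 0 h1).1), hπ.isLinked fun x => ⟨hU x, ?_⟩⟩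
  rintro ⟨j, h0, hj, rfl⟩
  rcases Nat.even_or_odd' j with ⟨k, rfl | rfl⟩
  · have := he (k - 1) (by omega)
    rw [show 2 * (k - 1) + 2 = 2 * k by omega] at this
    exact .inl this
  · exact .inr (ho k (by omega))

/-- Every node of the symmetric difference has window `T`, so there is at most one. -/
theorem isLinked_of_imset_eq_add (hΓ : IsCircular Γ) {G H : DAG p} (hG : G.skeleton = Γ)
    (hH : H.skeleton = Γ) {T : Finset (Fin p)} (hT : T.card = 3)
    (h : H.imset = G.imset + basisVec T) :
    G.colliders ≠ H.colliders ∧ IsLinked Γ (symmDiff G.colliders H.colliders) := by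
  classical
  constructor
  · intro hc
    rw [DAG.imset_eq_of_colliders_eq hΓ hG hH hc] at h
    have := congrFun h ⟨T, by omega⟩
    simp [basisVec] at this
  · have hall : ∀ x ∈ symmDiff G.colliders H.colliders, IsInner Γ x ∧ window x = T := by
      intro x hx
      have hxI : IsInner Γ x := hx.elim (fun h => DAG.isInner_of_mem_colliders hG h.1)
        fun h => DAG.isInner_of_mem_colliders hH h.1
      refine ⟨hxI, ?_⟩
      by_contra hne
      have := congrFun h ⟨window x, hxI.two_le_card_window⟩
      rw [Pi.add_apply, DAG.imset_window hΓ hG hxI, DAG.imset_window hΓ hH hxI, basisVec,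
        if_neg hne] at this
      rw [Set.mem_symmDiff] at hx
      by_cases h1 : x ∈ G.colliders <;> by_cases h2 : x ∈ H.colliders <;> simp_all
    intro P _ x hx hxP y hy
    obtain ⟨hxI, hxT⟩ := hall x hx
    obtain ⟨hyI, hyT⟩ := hall y hy
    rwa [← hxI.window_injective hyI (hxT.trans hyT.symm)]

theorem isLinked_of_isMove (hΓ : IsCircular Γ) {G H : DAG p} (hG : G.skeleton = Γ)
    (hH : H.skeleton = Γ) (h : IsVStructureAddition G H ∨ IsShift G H ∨ IsSplit G H) :
    G.colliders ≠ H.colliders ∧ IsLinked Γ (symmDiff G.colliders H.colliders) := by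
  have hsymm : H.colliders ≠ G.colliders ∧ IsLinked Γ (symmDiff H.colliders G.colliders) →
      G.colliders ≠ H.colliders ∧ IsLinked Γ (symmDiff G.colliders H.colliders) := by
    rw [symmDiff_comm]
    exact fun h => ⟨h.1.symm, h.2⟩
  have hshift : ∀ {G H : DAG p}, G.skeleton = Γ → H.skeleton = Γ → IsShiftFrom G H →
      G.colliders ≠ H.colliders ∧ IsLinked Γ (symmDiff G.colliders H.colliders) := by
    rintro G H hG hH ⟨m, π, h1, hπ, -, h⟩
    rw [hG, two_mul] at hπ
    exact hπ.isLinked_of_imset_sub_eq hΓ hG hH h1 (.inl rfl) h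
  have hsplit : ∀ {G H : DAG p}, G.skeleton = Γ → H.skeleton = Γ → IsSplitFrom G H →
      G.colliders ≠ H.colliders ∧ IsLinked Γ (symmDiff G.colliders H.colliders) := by
    rintro G H hG hH ⟨m, π, h1, hπ, -, h⟩
    rw [hG, show 2 * m = m + (m - 1) + 1 by omega] at hπ
    exact hπ.isLinked_of_imset_sub_eq hΓ hG hH h1 (.inr (by omega)) h
  rcases h with ⟨T, hT, h | h⟩ | (h | h) | (h | h)
  · exact isLinked_of_imset_eq_add hΓ hG hH hT h
  · exact hsymm (isLinked_of_imset_eq_add hΓ hH hG hT h)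
  · exact hshift hG hH h
  · exact hsymm (hshift hH hG h)
  · exact hsplit hG hH h
  · exact hsymm (hsplit hH hG h)

/-- The sequence of cyclically consecutive nodes starting from `v`. -/
def walkFrom (v : Fin p) (j : ℕ) : Fin p := ⟨(v.val + j) % p, Nat.mod_lt _ (NeZero.pos p)⟩

theorem walkFrom_zero (v : Fin p) : walkFrom v 0 = v :=
  Fin.ext (Nat.mod_eq_of_lt v.isLt)

theorem walkFrom_card (v : Fin p) : walkFrom v p = v :=
  Fin.ext (by simp [walkFrom, Nat.mod_eq_of_lt v.isLt])

theorem walkFrom_succ (v : Fin p) (j : ℕ) : walkFrom v (j + 1) = walkFrom v j + 1 := by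
  apply Fin.ext
  rw [Fin.val_add, Fin.val_one']
  simp [walkFrom, Nat.add_assoc]

theorem walkFrom_injOn (v : Fin p) {n : ℕ} (hn : n ≤ p) :
    Set.InjOn (walkFrom v) (Set.Ioo 0 (n + 1)) := by
  rintro i ⟨hi0, hin⟩ j ⟨hj0, hjn⟩ h
  have h1 : v.val + i ≡ v.val + j [MOD p] := congrArg Fin.val h
  have h2 : i ≡ j [MOD p] := Nat.ModEq.add_left_cancel' _ h1
  have h3 : (p : ℤ) ∣ (j : ℤ) - i := Nat.modEq_iff_dvd.1 h2
  obtain ⟨c, hc⟩ := h3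
  have hp : 0 < p := NeZero.pos p
  have : c = 0 := by
    by_contra hc0
    rcases lt_or_gt_of_ne hc0 with h | h
    · have : (p : ℤ) * c ≤ p * (-1) := mul_le_mul_of_nonneg_left (by omega) (by omega)
      omega
    · have : (p : ℤ) * 1 ≤ p * c := mul_le_mul_of_nonneg_left (by omega) (by omega)
      omega
  subst this
  omega

theorem exists_walkFrom_eq (v x : Fin p) : ∃ j, x = walkFrom v (j + 1) := by
  refine ⟨x.val + (p - v.val) + p - 1, Fin.ext ?_⟩
  have h1 := v.isLt
  have h2 := x.isLt
  have : v.val + (x.val + (p - v.val) + p - 1 + 1) = x.val + p + p := by omega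
  simp only [walkFrom, this, Nat.add_mod_right, Nat.mod_eq_of_lt h2]

theorem runsAlong_walkFrom (v : Fin p) {n : ℕ} (h1 : 1 ≤ n) (hn : n ≤ p)
    (hI : ∀ j, 0 < j → j < n + 1 → IsInner Γ (walkFrom v j)) :
    RunsAlong Γ (n + 1) (walkFrom v) := by
  have hleft : ∀ j, walkFrom v j = walkFrom v (j + 1) - 1 := by
    intro j; rw [walkFrom_succ]; simp
  refine ⟨fun k hk => ?_, walkFrom_injOn v hn, fun k hk => ?_⟩
  · rcases Nat.eq_zero_or_pos k with rfl | hk0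
    · have := (hI 1 (by omega) (by omega)).adj_left
      rwa [← hleft 0] at this
    · have := (hI k hk0 hk).adj_right
      rw [← walkFrom_succ] at this
      exact this.symm
  · have h := hI (k + 1) (by omega) (by omega)
    have e := hleft k
    have e' : walkFrom v (k + 2) = walkFrom v (k + 1) + 1 := walkFrom_succ v (k + 1)
    rw [e, e']
    exact ⟨h.ne, h.not_adj⟩

/-- A nonempty connected set of inner nodes is the set of inner nodes of a run. -/
theorem IsLinked.exists_run (hΓ : IsCircular Γ) {U : Set (Fin p)} (hU : IsLinked Γ U)
    (hI : ∀ x ∈ U, IsInner Γ x) (hne : U.Nonempty) :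
    ∃ (n : ℕ) (v : Fin p), 1 ≤ n ∧ RunsAlong Γ (n + 1) (walkFrom v) ∧
      ∀ x, x ∈ U ↔ ∃ j, 0 < j ∧ j < n + 1 ∧ x = walkFrom v j := by
  classical
  have hp : 0 < p := NeZero.pos p
  by_cases huniv : ∃ x, x ∉ U
  · obtain ⟨x, hx⟩ := huniv
    -- The run starts just before an entry into `U` and stops at the first exit, which exists
    -- because `v` itself recurs after `p` steps.
    obtain ⟨v, hv, hv1⟩ : ∃ v, v ∉ U ∧ v + 1 ∈ U := by
      by_contra hc
      push Not at hc
      obtain ⟨y, hy⟩ := hne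
      have hall : ∀ j, walkFrom x j ∉ U := by
        intro j
        induction j with
        | zero => rwa [walkFrom_zero]
        | succ j ih => rw [walkFrom_succ]; exact hc _ ih
      obtain ⟨j, hj⟩ := exists_walkFrom_eq x y
      exact hall _ (hj ▸ hy)
    have hex : ∃ N, walkFrom v (N + 1) ∉ U :=
      ⟨p - 1, by rw [Nat.sub_add_cancel hp, walkFrom_card]; exact hv⟩
    obtain ⟨n, hn, hmin⟩ : ∃ n, walkFrom v (n + 1) ∉ U ∧ ∀ k < n, walkFrom v (k + 1) ∈ U :=
      ⟨Nat.find hex, Nat.find_spec hex, fun k hk => not_not.1 (Nat.find_min hex hk)⟩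
    have hmem : ∀ j, 0 < j → j < n + 1 → walkFrom v j ∈ U := by
      intro j h0 hj
      have := hmin (j - 1) (by omega)
      rwa [Nat.sub_add_cancel h0] at this
    have hn1 : 1 ≤ n := by
      rcases Nat.eq_zero_or_pos n with rfl | h
      · rw [walkFrom_succ, walkFrom_zero] at hn
        exact absurd hv1 hn
      · exact h
    have hnp : n ≤ p := by
      by_contra hc
      have := hmem p hp (by omega)
      rw [walkFrom_card] at this
      exact hv this
    refine ⟨n, v, hn1, runsAlong_walkFrom v hn1 hnp fun j h0 hj => hI _ (hmem j h0 hj),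
      fun x => ⟨?_, ?_⟩⟩
    · intro hxU
      -- The arc is closed under adjacency in `U`, both nodes bounding it being outside `U`;
      -- linkedness makes it all of `U`.
      refine hU {x | ∃ j, 0 < j ∧ j < n + 1 ∧ x = walkFrom v j} ?_ (walkFrom v 1)
        (hmem 1 (by omega) (by omega)) ⟨1, by omega, by omega, rfl⟩ hxU
      rintro x hx y hy hxy ⟨j, h0, hj, rfl⟩
      rcases hΓ _ _ hxy with h | h
      · rw [← walkFrom_succ] at h
        refine ⟨j + 1, by omega, ?_, h⟩
        by_contra hc
        have : j = n := by omega
        subst this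
        exact hn (h ▸ hy)
      · obtain ⟨i, rfl⟩ : ∃ i, j = i + 1 := ⟨j - 1, by omega⟩
        rw [walkFrom_succ, add_left_inj] at h
        refine ⟨i, ?_, by omega, h.symm⟩
        rcases Nat.eq_zero_or_pos i with rfl | h'
        · rw [walkFrom_zero] at h
          exact absurd (h ▸ hy) hv
        · exact h'
    · rintro ⟨j, h0, hj, rfl⟩
      exact hmem j h0 hj
  · push Not at huniv
    -- Here the run goes round the whole cycle: the inner nodes, at positions 1 to `p`, exhaust all
    -- nodes, and the two end nodes repeat inner ones.
    refine ⟨p, 0, hp, runsAlong_walkFrom 0 hp le_rfl fun j _ _ => hI _ (huniv _),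
      fun x => ⟨fun _ => ?_, fun _ => huniv x⟩⟩
    rcases Nat.eq_zero_or_pos x.val with h | h
    · refine ⟨p, hp, by omega, ?_⟩
      rw [walkFrom_card]
      exact Fin.ext h
    · refine ⟨x.val, h, by omega, Fin.ext ?_⟩
      simp [walkFrom, Nat.mod_eq_of_lt x.isLt]

theorem isMove_of_isLinked (hΓ : IsCircular Γ) {G H : DAG p} (hG : G.skeleton = Γ)
    (hH : H.skeleton = Γ) (hne : G.colliders ≠ H.colliders)
    (h : IsLinked Γ (symmDiff G.colliders H.colliders)) : IsShift G H ∨ IsSplit G H := by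
  have hI : ∀ x ∈ symmDiff G.colliders H.colliders, IsInner Γ x := fun x hx =>
    hx.elim (fun h => DAG.isInner_of_mem_colliders hG h.1)
      fun h => DAG.isInner_of_mem_colliders hH h.1
  have hnon : (symmDiff G.colliders H.colliders).Nonempty := by
    rw [Set.nonempty_iff_ne_empty]
    exact fun h => hne (symmDiff_eq_bot.1 h)
  obtain ⟨n, v, hn, hπ, hU⟩ := h.exists_run hΓ hI hnon
  have key : ∀ {G H : DAG p}, G.skeleton = Γ → H.skeleton = Γ →
      (∀ x, x ∈ symmDiff G.colliders H.colliders ↔ ∃ j, 0 < j ∧ j < n + 1 ∧ x = walkFrom v j) →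
      walkFrom v 1 ∈ H.colliders → IsShiftFrom G H ∨ IsSplitFrom G H := by
    intro G H hG hH hU h1
    have hA : ∀ x ∈ G.colliders, ∀ y ∈ G.colliders, ¬ Γ.Adj x y :=
      fun x hx y hy => hG ▸ DAG.colliders_indep (hG ▸ hΓ) hx hy
    have hB : ∀ x ∈ H.colliders, ∀ y ∈ H.colliders, ¬ Γ.Adj x y :=
      fun x hx y hy => hH ▸ DAG.colliders_indep (hH ▸ hΓ) hx hy
    have hmem : ∀ j, 0 < j → j < n + 1 → walkFrom v j ∈ symmDiff H.colliders G.colliders :=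
      fun j h0 hj => symmDiff_comm G.colliders _ ▸ (hU _).2 ⟨j, h0, hj, rfl⟩
    have halt : ∀ j, j < n → (walkFrom v (j + 1) ∈ H.colliders ↔ Even j) := by
      intro j
      induction j with
      | zero => exact fun _ => iff_of_true h1 (by simp)
      | succ j ih =>
        intro hj
        have h2 := mem_or_of_indep hB hA (hmem (j + 1) (by omega) (by omega))
          (hmem (j + 1 + 1) (by omega) (by omega)) (hπ.adj (j + 1) (by omega))
        rw [Nat.even_add_one, ← ih (by omega), h2, not_not]
    have hodd : ∀ t, 2 * t < n → walkFrom v (2 * t + 1) ∈ H.colliders ∧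
        walkFrom v (2 * t + 1) ∉ G.colliders := by
      intro t ht
      have h2 := (halt (2 * t) ht).2 (by simp)
      exact ⟨h2, ((hmem (2 * t + 1) (by omega) (by omega)).resolve_right fun h => h.2 h2).2⟩
    have heven : ∀ t, 2 * t + 1 < n → walkFrom v (2 * t + 2) ∈ G.colliders ∧
        walkFrom v (2 * t + 2) ∉ H.colliders := by
      intro t ht
      have h2 : walkFrom v (2 * t + 2) ∉ H.colliders := fun h =>
        absurd ((halt (2 * t + 1) ht).1 h) (by simp)
      exact (hmem (2 * t + 2) (by omega) (by omega)).resolve_left fun h => h2 h.1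
    -- With `n` even there are as many odd as even centres, a shift; with `n` odd there is one more
    -- odd centre, a split.
    rcases Nat.even_or_odd' n with ⟨m, rfl | rfl⟩
    · left
      refine ⟨m, walkFrom v, by omega, hG ▸ hπ, hH ▸ hπ, ?_⟩
      have e : 2 * m + 1 = m + m + 1 := by omega
      rw [e] at hπ hU
      exact (hπ.imset_sub_eq_iff hΓ hG hH (.inl rfl)).2
        ⟨fun t ht => hodd t (by omega), fun t ht => heven t (by omega), fun x => (hU x).1⟩
    · right
      have e : 2 * m + 1 + 1 = 2 * (m + 1) := by omega
      have e' : 2 * m + 1 + 1 = m + 1 + m + 1 := by omega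
      refine ⟨m + 1, walkFrom v, by omega, hG ▸ e ▸ hπ, hH ▸ e ▸ hπ, ?_⟩
      rw [e'] at hπ hU
      exact (hπ.imset_sub_eq_iff hΓ hG hH (.inr rfl)).2
        ⟨fun t ht => hodd t (by omega), fun t ht => heven t (by omega), fun x => (hU x).1⟩
  have h1 : walkFrom v 1 ∈ symmDiff G.colliders H.colliders :=
    (hU _).2 ⟨1, by omega, by omega, rfl⟩
  -- The DAG in which the first inner node is a collider plays the role of the target.
  rcases h1 with ⟨h1, -⟩ | ⟨h1, -⟩
  · rcases key hH hG (symmDiff_comm G.colliders _ ▸ hU) h1 with h | h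
    · exact .inl (.inr h)
    · exact .inr (.inr h)
  · rcases key hG hH hU h1 with h | h
    · exact .inl (.inl h)
    · exact .inr (.inl h)

end Runs

/-! ### Specialization to the path and the cycle -/

section PathAndCycle

variable {p : ℕ} [NeZero p]

theorem cycleGraph_adj_iff (hp : 2 ≤ p) {u v : Fin p} :
    (SimpleGraph.cycleGraph p).Adj u v ↔ u - v = 1 ∨ v - u = 1 := by
  rw [SimpleGraph.cycleGraph_adj', Fin.ext_iff, Fin.ext_iff, Fin.val_one', Nat.mod_eq_of_lt hp]

theorem isCircular_cycleGraph (hp : 2 ≤ p) : IsCircular (SimpleGraph.cycleGraph p) := by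
  intro x y h
  rcases (cycleGraph_adj_iff hp).1 h with h | h
  · right; rw [← h]; simp
  · left; rw [← h]; simp

theorem isCircular_pathGraph (hp : 2 ≤ p) : IsCircular (SimpleGraph.pathGraph p) :=
  fun x y h => isCircular_cycleGraph hp x y (SimpleGraph.pathGraph_le_cycleGraph h)

theorem sub_one_ne_add_one_iff (x : Fin p) : x - 1 ≠ x + 1 ↔ (1 : Fin p) + 1 ≠ 0 := by
  rw [not_iff_not, sub_eq_iff_eq_add, add_assoc, left_eq_add]

theorem IsInner.sub_one_ne_add_one {Γ : SimpleGraph (Fin p)} {x : Fin p} (hx : IsInner Γ x)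
    (y : Fin p) : y - 1 ≠ y + 1 :=
  (sub_one_ne_add_one_iff y).2 ((sub_one_ne_add_one_iff x).1 hx.ne)

theorem IsInner.three_le {Γ : SimpleGraph (Fin p)} {x : Fin p} (hx : IsInner Γ x) : 3 ≤ p := by
  rw [← hx.card_window]
  exact (Finset.card_le_univ _).trans_eq (Fintype.card_fin p)

/-- Rotational symmetry: only differences of nodes enter. The triangle has no inner node at all. -/
theorem IsInner.cycleGraph (hp : 2 ≤ p) {x : Fin p} (hx : IsInner (SimpleGraph.cycleGraph p) x)
    (y : Fin p) : IsInner (SimpleGraph.cycleGraph p) y := by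
  refine ⟨hx.sub_one_ne_add_one y, ?_, ?_, ?_⟩
  · have h := hx.not_adj
    rw [cycleGraph_adj_iff hp] at h ⊢
    rwa [show y - 1 - (y + 1) = x - 1 - (x + 1) by abel,
      show y + 1 - (y - 1) = x + 1 - (x - 1) by abel]
  · rw [cycleGraph_adj_iff hp]; right; abel
  · rw [cycleGraph_adj_iff hp]; left; abel

/-- A sink receives both its edges, hence is a collider. -/
theorem colliders_nonempty_of_cycleGraph {D : DAG p}
    (hD : D.skeleton = SimpleGraph.cycleGraph p)
    (hI : ∀ x, IsInner (SimpleGraph.cycleGraph p) x) : D.colliders.Nonempty := by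
  obtain ⟨x, -, hx⟩ := D.exists_sink Set.univ ⟨0, trivial⟩
  have key : ∀ y, D.skeleton.Adj y x → D.Adj y x := fun y h =>
    (D.skeleton_adj.1 h).resolve_right (hx y trivial)
  have hix : IsInner D.skeleton x := hD ▸ hI x
  exact ⟨x, hix, key _ hix.adj_left, key _ hix.adj_right⟩

theorem exists_mem_of_ne {α : Type*} {A B : Set α} (h : A ≠ B) : ∃ x, x ∈ A ∨ x ∈ B := by
  by_contra hc
  push Not at hc
  exact h (Set.ext fun x => iff_of_false (hc x).1 (hc x).2)

theorem exists_isInner_of_colliders_ne {Γ : SimpleGraph (Fin p)} {G H : DAG p}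
    (hG : G.skeleton = Γ) (hH : H.skeleton = Γ) (h : G.colliders ≠ H.colliders) :
    ∃ x, IsInner Γ x := by
  obtain ⟨x, hx | hx⟩ := exists_mem_of_ne h
  exacts [⟨x, DAG.isInner_of_mem_colliders hG hx⟩, ⟨x, DAG.isInner_of_mem_colliders hH hx⟩]

theorem not_pathGraph_adj_zero (hp : 3 ≤ p) :
    ¬ (SimpleGraph.pathGraph p).Adj 0 ((0 : Fin p) - 1) := by
  rw [SimpleGraph.pathGraph_adj]
  have h1 : ((1 : Fin p)).val = 1 := by rw [Fin.val_one', Nat.mod_eq_of_lt (by omega)]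
  have h2 : ((0 : Fin p) - 1).val = p - 1 := by
    rw [Fin.val_sub, h1, Fin.val_zero, Nat.add_zero, Nat.mod_eq_of_lt (by omega)]
  rw [h2, Fin.val_zero]
  omega

theorem isPolytopeEdge_pathGraph_iff (hp : 2 ≤ p) {G H : DAG p}
    (hG : G.skeleton = SimpleGraph.pathGraph p) (hH : H.skeleton = SimpleGraph.pathGraph p) :
    IsPolytopeEdge (CIM (SimpleGraph.pathGraph p)) (convexHull ℝ {G.imset, H.imset}) ↔
      IsVStructureAddition G H ∨ IsShift G H ∨ IsSplit G H := by
  have hΓ := isCircular_pathGraph hp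
  constructor
  · intro h
    have hne : G.colliders ≠ H.colliders := fun hc =>
      h.ne (DAG.imset_eq_of_colliders_eq hΓ hG hH hc)
    obtain ⟨x, hx⟩ := exists_isInner_of_colliders_ne hG hH hne
    -- On the path the empty collider set is allowed, and the node 0 breaks the cyclic order since
    -- it is not adjacent to `0 - 1`.
    have := h.isLinked_or_singletons hΓ hG hH True (fun A hI hA _ =>
      exists_colliders_eq hΓ A hI hA hx.sub_one_ne_add_one 0
        fun h0 => absurd h0 (not_pathGraph_adj_zero hx.three_le)) (.inr trivial) (.inr trivial)
    exact .inr (isMove_of_isLinked hΓ hG hH hne (this.resolve_right fun h => h.1 trivial))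
  · intro h
    obtain ⟨hne, hU⟩ := isLinked_of_isMove hΓ hG hH h
    exact isPolytopeEdge_of_isLinked hΓ hG hH hne hU

theorem isPolytopeEdge_cycleGraph_iff (hp : 2 ≤ p) {G H : DAG p}
    (hG : G.skeleton = SimpleGraph.cycleGraph p) (hH : H.skeleton = SimpleGraph.cycleGraph p) :
    IsPolytopeEdge (CIM (SimpleGraph.cycleGraph p)) (convexHull ℝ {G.imset, H.imset}) ↔
      IsVStructureAddition G H ∨ IsShift G H ∨ IsSplit G H ∨
        (G.imset ≠ H.imset ∧ G.vStructures.ncard = 1 ∧ H.vStructures.ncard = 1) := by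
  have hΓ := isCircular_cycleGraph hp
  rw [DAG.ncard_vStructures hΓ hG, DAG.ncard_vStructures hΓ hH, Set.ncard_eq_one,
    Set.ncard_eq_one]
  constructor
  · intro h
    have hne : G.colliders ≠ H.colliders := fun hc =>
      h.ne (DAG.imset_eq_of_colliders_eq hΓ hG hH hc)
    obtain ⟨x, hx⟩ := exists_isInner_of_colliders_ne hG hH hne
    have hI := hx.cycleGraph hp
    -- On the cycle any collider can serve as the breaking node `s`, which is why the set has to be
    -- nonempty.
    rcases h.isLinked_or_singletons hΓ hG hH False (fun A hI hA hAe => by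
        obtain ⟨s, hs⟩ := hAe.resolve_right id
        exact exists_colliders_eq hΓ A hI hA hx.sub_one_ne_add_one s fun _ => hs)
      (.inl (colliders_nonempty_of_cycleGraph hG hI))
      (.inl (colliders_nonempty_of_cycleGraph hH hI)) with hU | ⟨-, a, b, -, ha, hb⟩
    · rcases isMove_of_isLinked hΓ hG hH hne hU with h | h
      exacts [.inr (.inl h), .inr (.inr (.inl h))]
    · exact .inr (.inr (.inr ⟨h.ne, ⟨a, ha⟩, ⟨b, hb⟩⟩))
  · have hmove : IsVStructureAddition G H ∨ IsShift G H ∨ IsSplit G H →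
        IsPolytopeEdge (CIM (SimpleGraph.cycleGraph p)) (convexHull ℝ {G.imset, H.imset}) := by
      intro h
      obtain ⟨hne, hU⟩ := isLinked_of_isMove hΓ hG hH h
      exact isPolytopeEdge_of_isLinked hΓ hG hH hne hU
    rintro (h | h | h | ⟨hne, ⟨a, ha⟩, ⟨b, hb⟩⟩)
    · exact hmove (.inl h)
    · exact hmove (.inr (.inl h))
    · exact hmove (.inr (.inr h))
    · have hab : a ≠ b := by
        rintro rfl
        exact hne (DAG.imset_eq_of_colliders_eq hΓ hG hH (ha.trans hb.symm))
      have hx : IsInner (SimpleGraph.cycleGraph p) a :=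
        DAG.isInner_of_mem_colliders hG (by rw [ha]; rfl)
      exact isPolytopeEdge_of_singletons hΓ hG hH hab ha hb fun D hD =>
        colliders_nonempty_of_cycleGraph hD (hx.cycleGraph hp)

end PathAndCycle

theorem mainTheorem3 :
    (∀ (p : ℕ), 2 ≤ p → ∀ (G H : DAG p),
      G.skeleton = SimpleGraph.pathGraph p → H.skeleton = SimpleGraph.pathGraph p →
      (IsPolytopeEdge (CIM (SimpleGraph.pathGraph p)) (convexHull ℝ {G.imset, H.imset}) ↔
        IsVStructureAddition G H ∨ IsShift G H ∨ IsSplit G H)) ∧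
    (∀ (p : ℕ), 3 ≤ p → ∀ (G H : DAG p),
      G.skeleton = SimpleGraph.cycleGraph p → H.skeleton = SimpleGraph.cycleGraph p →
      (IsPolytopeEdge (CIM (SimpleGraph.cycleGraph p)) (convexHull ℝ {G.imset, H.imset}) ↔
        IsVStructureAddition G H ∨ IsShift G H ∨ IsSplit G H ∨
          (G.imset ≠ H.imset ∧ G.vStructures.ncard = 1 ∧ H.vStructures.ncard = 1))) := by
  refine ⟨fun p hp G H hG hH => ?_, fun p hp G H hG hH => ?_⟩
  · have : NeZero p := ⟨by omega⟩
    exact isPolytopeEdge_pathGraph_iff hp hG hH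
  · have : NeZero p := ⟨by omega⟩
    exact isPolytopeEdge_cycleGraph_iff (by omega) hG hH
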